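/- **Setting.** Fix $p$ and $0<d_0<p$. For each sample size $N$ there are independent observations $Z_i=(X_i,Y_i)\in\mathbb R^{p}\times\mathbb R$, $i=1,\dots,N$, split among $K=K_N$ workers into blocks $\mathcal S_1,\dots,\mathcal S_K$ of sizes $n_k=|\mathcal S_k|$; the observations on worker $k$ are identically distributed with a law $P_k$ that may depend on $k$. Put $n=N/K$, $\alpha_k=n_k/N$, and assume $c_1 n\le n_k\le c_2 n$ for all $k$, with constants $c_1,c_2>0$, and $n/\sqrt N\to\infty$ (automatic if $K_N$ is bounded). Let $\mathcal L(\theta;Z)$ be the loss, $\mathcal L_k(\theta)=n_k^{-1}\sum_{i\in\mathcal S_k}\mathcal L(\theta;Z_i)$, $\mathcal L(\theta)=N^{-1}\sum_{i}\mathcal L(\theta;Z_i)$, and let $\theta_0\in\mathbb R^p$ be the true value, with $\theta_{0,j}\neq0$ exactly for $j\in\mathcal M_T=\{1,\dots,d_0\}$. Write $v^{(\mathcal M)}=(v_j)_{j\in\mathcal M}$ and $A^{(\mathcal M)}=(a_{ij})_{i,j\in\mathcal M}$. Dots denote derivatives in $\theta$, "argmin" means a minimizer with probability tending to one, and conditions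 on $P_k$ are required for every worker $k$ that occurs. Assume: * (C1) The parameter space $\Theta\subset\mathbb R^p$ is compact and convex, and $\theta_0$ lies in its interior. * (C2) The observations are sampled as described above. * (C3) For every $\delta>0$ there is $\varepsilon>0$ with $P\{\mathcal L_k(\theta)-\mathcal L_k(\theta_0)\ge\varepsilon\ \text{for all } k\le K \text{ and all } \theta\in\Theta,\ \|\theta-\theta_0\|\ge\delta\}\to1$; and $E\{\dot{\mathcal L}(\theta_0;Z)\}=0$ for $Z\sim P_k$. * (C4) The matrix $\Omega_k(\theta_0)=E\{\dot{\mathcal L}(\theta_0;Z)\dot{\mathcal L}(\theta_0;Z)^\top\}=E\{\ddot{\mathcal L}(\theta_0;Z)\}$, $Z\sim P_k$, exists (both expectations are finite and equal) and is nonsingular. * (C5) For some $\delta>0$, for $P_k$-almost every $Z$, $\mathcal L(\cdot;Z)$ is three times differentiable at every $\theta\in\Theta$ with $\|\theta-\theta_0\|\le\delta$, and there $|\partial^3\mathcal L(\theta;Z)/\partial\theta_i\partial\theta_j\partial\theta_l|\le M_{ijl}(Z)$, where $E\,M_{ijl}(Z)<\infty$ for $Z\sim P_k$. * (Uniformity)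 Either $K_N$ is bounded, or the conditions hold uniformly over the workers: there are $c,\eta>0$ and $C<\infty$ such that for all $k$, $i,j,l$ and $Z\sim P_k$ the smallest eigenvalue of $\Omega_k(\theta_0)$ is at least $c$, and $E|\partial_i\mathcal L(\theta_0;Z)|^{2+\eta}$, $E|\partial_i\partial_j\mathcal L(\theta_0;Z)|^2$, $E\,M_{ijl}(Z)^2$ are at most $C$. * (C6) For every $\mathcal M\supseteq\mathcal M_T$, the global unpenalized estimator $\widehat\theta_{\mathcal M}=\arg\min\{\mathcal L(\theta):\theta\in\Theta,\ \theta_j=0\ \forall j\notin\mathcal M\}$ satisfies $\sqrt N(\widehat\theta_{\mathcal M}^{(\mathcal M)}-\theta_0^{(\mathcal M)})\to_d N(0,\Sigma_{\mathcal M})$ with $\Sigma_{\mathcal M}=\Omega_{\mathcal M}^{-1}$ positive definite, and $\Omega_{\mathcal M}=\Omega_{\mathcal M_F}^{(\mathcal M)}$, where $\mathcal M_F=\{1,\dots,p\}$. Let $\widehat\theta_k=\arg\min_{\theta\in\Theta}\mathcal L_k(\theta)$ (for all $k\le K$ simultaneously) and $\widehat\Sigma_k^{-1}=n_k^{-1}\sum_{i\in\mathcal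 S_k}\ddot{\mathcal L}(\widehat\theta_k;Z_i)$. For (possibly random) penalties $\lambda_1,\dots,\lambda_p\ge0$ depending on $N$, let $\widetilde\theta_\lambda$ be the random vector $$\widetilde\theta_\lambda=\arg\min_{\theta\in\mathbb R^p}\Big\{\sum_{k=1}^K\alpha_k(\theta-\widehat\theta_k)^\top\widehat\Sigma_k^{-1}(\theta-\widehat\theta_k)+\sum_{j=1}^p\lambda_j|\theta_j|\Big\},$$ and put $a_\lambda=\max_{j\le d_0}\lambda_j$, $b_\lambda=\min_{j>d_0}\lambda_j$. **Theorem (Oracle Property).** If, as $N\to\infty$, $\sqrt N a_\lambda\to0$ and $\sqrt N b_\lambda\to\infty$ in probability, then $$\sqrt N\big(\widetilde\theta_\lambda^{(\mathcal M_T)}-\theta_0^{(\mathcal M_T)}\big)\to_d N(0,\Sigma_{\mathcal M_T}),$$ where $\Sigma_{\mathcal M_T}$ is the asymptotic covariance in (C6) of the oracle estimator $\widehat\theta_{\mathcal M_T}$, the global estimator fitted under the true model. -/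

import Mathlib

open MeasureTheory ProbabilityTheory Filter Topology
open scoped Matrix ENNReal NNReal

namespace DLSA

/-- An event `A N` holds with probability tending to one.  It is phrased through the (outer)
probability of the complement, so that it is meaningful without measurability of `A N`. -/
def WithHighProb {Ω : Type*} [MeasurableSpace Ω] (P : Measure Ω) (A : ℕ → Ω → Prop) : Prop :=
  Tendsto (fun N => P {ω | ¬ A N ω}) atTop (𝓝 0)

/-- `X N → ∞` in probability. -/
def TendstoInProbAtTop {Ω : Type*} [MeasurableSpace Ω] (P : Measure Ω) (X : ℕ → Ω → ℝ) : Prop :=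
  ∀ C : ℝ, WithHighProb P (fun N ω => C ≤ X N ω)

/-- The sub-vector `v^{(M)} = (v_j : j ∈ M)`. -/
noncomputable def restrict {p : ℕ} (M : Finset (Fin p)) (v : EuclideanSpace ℝ (Fin p)) :
    EuclideanSpace ℝ M :=
  WithLp.toLp 2 (fun j : M => v j)

/-- First partial derivative `∂f/∂θ_i`. -/
noncomputable def pd1 {p : ℕ} (f : EuclideanSpace ℝ (Fin p) → ℝ)
    (θ : EuclideanSpace ℝ (Fin p)) (i : Fin p) : ℝ :=
  fderiv ℝ f θ (EuclideanSpace.single i 1)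

/-- Second partial derivative `∂²f/∂θ_i∂θ_j`. -/
noncomputable def pd2 {p : ℕ} (f : EuclideanSpace ℝ (Fin p) → ℝ)
    (θ : EuclideanSpace ℝ (Fin p)) (i j : Fin p) : ℝ :=
  iteratedFDeriv ℝ 2 f θ ![EuclideanSpace.single i 1, EuclideanSpace.single j 1]

/-- Third partial derivative `∂³f/∂θ_i∂θ_j∂θ_l`. -/
noncomputable def pd3 {p : ℕ} (f : EuclideanSpace ℝ (Fin p) → ℝ)
    (θ : EuclideanSpace ℝ (Fin p)) (i j l : Fin p) : ℝ :=
  iteratedFDeriv ℝ 3 f θ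
    ![EuclideanSpace.single i 1, EuclideanSpace.single j 1, EuclideanSpace.single l 1]

/-- The data of a distributed estimation problem with `p` parameters: the parameter space, the
true parameter, the loss of a parameter at an observation `(x, y) ∈ ℝ^p × ℝ`, the number `K N` of
workers holding a sample of size `N`, the worker to which each observation is assigned, the
distribution of the observations on the `k`-th worker, and the observations themselves. -/
structure Model (p : ℕ) (Ω : Type*) where
  /-- parameter space -/
  Θ : Set (EuclideanSpace ℝ (Fin p))
  /-- true parameter -/
  θ₀ : EuclideanSpace ℝ (Fin p)
  /-- loss function -/
  loss : EuclideanSpace ℝ (Fin p) → EuclideanSpace ℝ (Fin p) × ℝ → ℝ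
  /-- number of workers -/
  K : ℕ → ℕ
  /-- assignment of the observations to the workers -/
  worker : (N : ℕ) → Fin N → Fin (K N)
  /-- distribution of an observation on worker `k` -/
  law : ℕ → Measure (EuclideanSpace ℝ (Fin p) × ℝ)
  /-- observations -/
  Z : (N : ℕ) → Fin N → Ω → EuclideanSpace ℝ (Fin p) × ℝ

namespace Model

variable {p : ℕ} {Ω : Type*} (S : Model p Ω)

/-- The observations on worker `k`. -/
def block (N : ℕ) (k : Fin (S.K N)) : Finset (Fin N) :=
  Finset.univ.filter (fun i => S.worker N i = k)

/-- The local sample size `n_k`. -/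
def size (N : ℕ) (k : Fin (S.K N)) : ℕ := (S.block N k).card

/-- The average local sample size `n = N / K`. -/
noncomputable def avgSize (N : ℕ) : ℝ := (N : ℝ) / (S.K N : ℝ)

/-- The weight `α_k = n_k / N`. -/
noncomputable def weight (N : ℕ) (k : Fin (S.K N)) : ℝ := (S.size N k : ℝ) / (N : ℝ)

/-- The local loss `L_k(θ) = n_k⁻¹ ∑_{i ∈ S_k} L(θ; Z_i)`. -/
noncomputable def localLoss (N : ℕ) (ω : Ω) (k : Fin (S.K N))
    (θ : EuclideanSpace ℝ (Fin p)) : ℝ :=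
  (S.size N k : ℝ)⁻¹ * ∑ i ∈ S.block N k, S.loss θ (S.Z N i ω)

/-- The global loss `L(θ) = N⁻¹ ∑_i L(θ; Z_i)`. -/
noncomputable def globalLoss (N : ℕ) (ω : Ω) (θ : EuclideanSpace ℝ (Fin p)) : ℝ :=
  (N : ℝ)⁻¹ * ∑ i, S.loss θ (S.Z N i ω)

/-- The matrix `n_k⁻¹ ∑_{i ∈ S_k} L̈(θ; Z_i)` of averaged second derivatives on worker `k`; at the
local estimator it is the matrix `Σ̂_k⁻¹` sent to the master. -/
noncomputable def localHessian (N : ℕ) (ω : Ω) (k : Fin (S.K N))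
    (θ : EuclideanSpace ℝ (Fin p)) : Matrix (Fin p) (Fin p) ℝ :=
  Matrix.of fun a b =>
    (S.size N k : ℝ)⁻¹ * ∑ i ∈ S.block N k, pd2 (fun θ' => S.loss θ' (S.Z N i ω)) θ a b

/-- The weighted least squares objective
`L̃(θ) = ∑_k α_k (θ - θ̂_k)ᵀ Σ̂_k⁻¹ (θ - θ̂_k)` built from local estimators `θ̂_k`. -/
noncomputable def lsaLoss (N : ℕ) (ω : Ω) (θhat : Fin (S.K N) → EuclideanSpace ℝ (Fin p))
    (θ : EuclideanSpace ℝ (Fin p)) : ℝ :=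
  ∑ k, S.weight N k *
    ((θ - θhat k).ofLp ⬝ᵥ (S.localHessian N ω k (θhat k) *ᵥ (θ - θhat k).ofLp))

/-- The adaptive Lasso objective `Q_λ(θ) = L̃(θ) + ∑_j λ_j |θ_j|`. -/
noncomputable def lassoObjective (N : ℕ) (ω : Ω)
    (θhat : Fin (S.K N) → EuclideanSpace ℝ (Fin p)) (lam : Fin p → ℝ)
    (θ : EuclideanSpace ℝ (Fin p)) : ℝ :=
  S.lsaLoss N ω θhat θ + ∑ j, lam j * |θ j|

/-- The information matrix `Ω_k(θ₀) = E[L̇(θ₀; Z) L̇(θ₀; Z)ᵀ]` of worker `k`. -/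
noncomputable def info (k : ℕ) : Matrix (Fin p) (Fin p) ℝ :=
  Matrix.of fun a b => ∫ z, pd1 (fun θ => S.loss θ z) S.θ₀ a *
    pd1 (fun θ => S.loss θ z) S.θ₀ b ∂(S.law k)

/-- Worker sizes are of the same order: `c₁ n ≤ n_k ≤ c₂ n` for all `k`. -/
def BalancedWorkers : Prop :=
  ∃ c₁ c₂ : ℝ, 0 < c₁ ∧ 0 < c₂ ∧ ∀ (N : ℕ) (k : Fin (S.K N)),
    c₁ * S.avgSize N ≤ (S.size N k : ℝ) ∧ (S.size N k : ℝ) ≤ c₂ * S.avgSize N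

/-- Parameter space: `Θ` is compact and convex, with `θ₀` in its interior. -/
def ParameterSpace : Prop :=
  IsCompact S.Θ ∧ Convex ℝ S.Θ ∧ S.θ₀ ∈ interior S.Θ

/-- Sampling: for each sample size the observations are independent, those on worker `k` having
the common distribution `law k` (so the covariates there are i.i.d. from its first marginal). -/
def Sampling [MeasurableSpace Ω] (P : Measure Ω) : Prop :=
  ∀ N : ℕ, (∀ i, Measurable (S.Z N i)) ∧ iIndepFun (S.Z N) P ∧
    ∀ i, P.map (S.Z N i) = S.law (S.worker N i)

/-- Identifiability, uniformly over the workers, together with the vanishing of the expected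
gradient at the true parameter. -/
def Identifiability [MeasurableSpace Ω] (P : Measure Ω) : Prop :=
  (∀ δ > 0, ∃ ε > 0, WithHighProb P (fun N ω => ∀ k : Fin (S.K N), ∀ θ ∈ S.Θ,
      δ ≤ ‖θ - S.θ₀‖ → ε ≤ S.localLoss N ω k θ - S.localLoss N ω k S.θ₀)) ∧
  ∀ (N : ℕ) (k : Fin (S.K N)) (a : Fin p),
    Integrable (fun z => pd1 (fun θ => S.loss θ z) S.θ₀ a) (S.law k) ∧
    ∫ z, pd1 (fun θ => S.loss θ z) S.θ₀ a ∂(S.law k) = 0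

/-- Local convexity: the second moments of the gradient and the expected second derivatives exist
at `θ₀`, they coincide, and their common value `Ω_k(θ₀)` is nonsingular. -/
def LocalConvexity : Prop :=
  ∀ (N : ℕ) (k : Fin (S.K N)),
    (∀ a, MemLp (fun z => pd1 (fun θ => S.loss θ z) S.θ₀ a) 2 (S.law k)) ∧
    (∀ a b, Integrable (fun z => pd2 (fun θ => S.loss θ z) S.θ₀ a b) (S.law k) ∧
      ∫ z, pd2 (fun θ => S.loss θ z) S.θ₀ a b ∂(S.law k) = S.info k a b) ∧
    IsUnit (S.info k).det

/-- Smoothness: on a neighbourhood `B(δ)` of `θ₀` in `Θ` the loss is, for almost every observation,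
three times differentiable, with third partial derivatives bounded by `Mb i j l`, a function of
the observation. -/
def SmoothnessWith
    (Mb : Fin p → Fin p → Fin p → EuclideanSpace ℝ (Fin p) × ℝ → ℝ) : Prop :=
  ∃ δ > 0, ∀ (N : ℕ) (k : Fin (S.K N)),
    (∀ᵐ z ∂(S.law k), ∀ θ ∈ S.Θ, ‖θ - S.θ₀‖ ≤ δ →
      ContDiffAt ℝ 2 (fun θ' => S.loss θ' z) θ ∧
      DifferentiableAt ℝ (iteratedFDeriv ℝ 2 (fun θ' => S.loss θ' z)) θ ∧
      ∀ i j l, |pd3 (fun θ' => S.loss θ' z) θ i j l| ≤ Mb i j l z) ∧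
    ∀ i j l, Integrable (Mb i j l) (S.law k)

/-- Uniformity over the workers, for use when their number grows with the sample size: the
information matrices are uniformly positive definite, the gradients at `θ₀` have uniformly bounded
moments of some order larger than two, and the second derivatives at `θ₀` and the bounds `Mb` on
the third derivatives have uniformly bounded second moments. -/
def UniformMoments
    (Mb : Fin p → Fin p → Fin p → EuclideanSpace ℝ (Fin p) × ℝ → ℝ) : Prop :=
  ∃ (c η : ℝ) (C : ℝ≥0), 0 < c ∧ 0 < η ∧ ∀ (N : ℕ) (k : Fin (S.K N)),
    (∀ v : Fin p → ℝ, c * (v ⬝ᵥ v) ≤ v ⬝ᵥ (S.info k *ᵥ v)) ∧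
    (∀ a, eLpNorm (fun z => pd1 (fun θ => S.loss θ z) S.θ₀ a)
      (ENNReal.ofReal (2 + η)) (S.law k) ≤ C) ∧
    (∀ a b, eLpNorm (fun z => pd2 (fun θ => S.loss θ z) S.θ₀ a b) 2 (S.law k) ≤ C) ∧
    ∀ i j l, eLpNorm (Mb i j l) 2 (S.law k) ≤ C

/-- With probability tending to one, `θ̂_k` minimizes the local loss over `Θ`, for all workers. -/
def IsLocalEstimator [MeasurableSpace Ω] (P : Measure Ω)
    (θhat : (N : ℕ) → Ω → Fin (S.K N) → EuclideanSpace ℝ (Fin p)) : Prop :=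
  WithHighProb P (fun N ω => ∀ k, θhat N ω k ∈ S.Θ ∧
    IsMinOn (S.localLoss N ω k) S.Θ (θhat N ω k))

/-- With probability tending to one, `θ̃_λ` minimizes the adaptive Lasso objective over `ℝ^p`. -/
def IsShrinkageEstimator [MeasurableSpace Ω] (P : Measure Ω)
    (θhat : (N : ℕ) → Ω → Fin (S.K N) → EuclideanSpace ℝ (Fin p))
    (lam : ℕ → Ω → Fin p → ℝ) (θlam : ℕ → Ω → EuclideanSpace ℝ (Fin p)) : Prop :=
  WithHighProb P (fun N ω =>
    IsMinOn (S.lassoObjective N ω (θhat N ω) (lam N ω)) Set.univ (θlam N ω))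

/-- With probability tending to one, `θ̂_M` minimizes the global loss over the parameters supported
on `M`.  (An asymptotically normal minimizer over all `θ ∈ ℝ^p` supported on `M` lies in `Θ` with
probability tending to one, so it is covered.) -/
def IsGlobalEstimator [MeasurableSpace Ω] (P : Measure Ω) (M : Finset (Fin p))
    (θM : ℕ → Ω → EuclideanSpace ℝ (Fin p)) : Prop :=
  WithHighProb P (fun N ω => θM N ω ∈ {θ ∈ S.Θ | ∀ j ∉ M, θ j = 0} ∧
    IsMinOn (S.globalLoss N ω) {θ ∈ S.Θ | ∀ j ∉ M, θ j = 0} (θM N ω))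

/-- `√N (θ̂^{(M)} - θ₀^{(M)})` converges in distribution to `N(0, V)`. -/
def AsymptoticallyNormal [MeasurableSpace Ω] (P : Measure Ω) [IsProbabilityMeasure P]
    (M : Finset (Fin p)) (θhat : ℕ → Ω → EuclideanSpace ℝ (Fin p)) (V : Matrix M M ℝ) : Prop :=
  TendstoInDistribution
    (fun (N : ℕ) ω => Real.sqrt N • (restrict M (θhat N ω) - restrict M S.θ₀)) atTop
    (id : EuclideanSpace ℝ M → EuclideanSpace ℝ M) (fun _ => P) (multivariateGaussian 0 V)

/-- Covariance assumption: for every `M ⊇ M_T`, the global unpenalized estimator `θ̂_M` on `M` is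
asymptotically normal with positive definite covariance `Σ_M = Ω_M⁻¹`, and `Ω_M` is the
`M`-block of the matrix `Ω` of the full model. -/
def CovarianceAssumption [MeasurableSpace Ω] (P : Measure Ω) [IsProbabilityMeasure P]
    (MT : Finset (Fin p)) (θM : Finset (Fin p) → ℕ → Ω → EuclideanSpace ℝ (Fin p))
    (SigmaM : (M : Finset (Fin p)) → Matrix M M ℝ) : Prop :=
  ∀ M : Finset (Fin p), MT ⊆ M →
    S.IsGlobalEstimator P M (θM M) ∧
    (SigmaM M).PosDef ∧
    S.AsymptoticallyNormal P M (θM M) (SigmaM M) ∧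
    (SigmaM M)⁻¹ = ((SigmaM Finset.univ)⁻¹).submatrix
      (fun j => ⟨j.1, Finset.mem_univ _⟩) (fun j => ⟨j.1, Finset.mem_univ _⟩)

end Model

/-- The true model `M_T`: the first `d₀` coordinates. -/
def trueModel (p d₀ : ℕ) : Finset (Fin p) := Finset.univ.filter (fun j => (j : ℕ) < d₀)

/-- `a_λ`, the largest penalty on the coordinates of the true model. -/
noncomputable def aLam {p : ℕ} (d₀ : ℕ) (lam : Fin p → ℝ) : ℝ :=
  ⨆ j : {j : Fin p // (j : ℕ) < d₀}, lam j

/-- `b_λ`, the smallest penalty on the coordinates outside the true model. -/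
noncomputable def bLam {p : ℕ} (d₀ : ℕ) (lam : Fin p → ℝ) : ℝ :=
  ⨅ j : {j : Fin p // ¬ (j : ℕ) < d₀}, lam j

end DLSA

/-! In the displacement `x` from `θ₀` the shrinkage objective is, up to an additive constant, `H x x
- 2 * w x` plus the penalty. Here `H` is the weighted average of the local Hessians at the local
estimators, and `w` averages these Hessians applied to `θhat k - θ₀`. With probability tending to
one every local estimator is an interior critical point, so a Taylor expansion of its score gives `w
= -∇L(θ₀)` up to a constant times the weighted sum of squared local scores at `θ₀`. Centring and
independence bound the expectation of that sum by a multiple of `K / N`, and `n / √N → ∞` says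
exactly that `K / N = o(N^{-1/2})`. To the relevant order the surrogate and the global loss
therefore have the same score.

What remains is a comparison of two minimizers; no new central limit theorem is needed. Comparing
the objective at `x` with its value at `0` gives `√N`-consistency, because `√N a_λ → 0`. Comparing
it with its value at the projection of `x` to the true coordinates shows that `x` vanishes
elsewhere, because `√N b_λ → ∞`. On the true coordinates the oracle almost solves the score equation
with the Hessian `L` at `θ₀`, and the shrinkage estimator almost solves it with `H`; coercivity
turns the difference of the two equations into an `o_p(N^{-1/2})` distance. Slutsky's theorem then
transfers the limit law of the oracle. The local estimators enter `H - L` only through consistency,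
since `H - L` multiplies the oracle error, which is already `O_p(N^{-1/2})`.

The deterministic half is `shrinkage_oracle_bounds`, resting on `lasso_dist_le` and
`norm_score_add_hessian_le`. The stochastic half is `Sampling.exists_regularAt`, a law of large
numbers uniform over the workers, together with `Sampling.withHighProb_weighted_score_le`. They meet
in `withHighProb_sqrt_mul_norm_sub_le`. -/

set_option maxSynthPendingDepth 3

namespace DLSA

/-! ### From partial derivatives to operator norms. -/

theorem abs_apply_le_sum_single {p : ℕ} (f : EuclideanSpace ℝ (Fin p) →ₗ[ℝ] ℝ)
    (v : EuclideanSpace ℝ (Fin p)) :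
    |f v| ≤ (∑ i, |f (EuclideanSpace.single i 1)|) * ‖v‖ := by
  have h : v = ∑ i, v i • EuclideanSpace.single i (1 : ℝ) := by
    simpa using ((EuclideanSpace.basisFun (Fin p) ℝ).sum_repr v).symm
  conv_lhs => rw [h]
  rw [map_sum, Finset.sum_mul]
  refine (Finset.abs_sum_le_sum_abs _ _).trans (Finset.sum_le_sum fun i _ => ?_)
  rw [map_smul, smul_eq_mul, abs_mul, mul_comm]
  gcongr
  exact PiLp.norm_apply_le v i

theorem norm_le_sum_single {p : ℕ} (f : EuclideanSpace ℝ (Fin p) →L[ℝ] ℝ) :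
    ‖f‖ ≤ ∑ i, |f (EuclideanSpace.single i 1)| :=
  f.opNorm_le_bound (by positivity) fun v => abs_apply_le_sum_single (f : _ →ₗ[ℝ] ℝ) v

theorem norm_le_sum_single₂ {p : ℕ}
    (f : EuclideanSpace ℝ (Fin p) →L[ℝ] EuclideanSpace ℝ (Fin p) →L[ℝ] ℝ) :
    ‖f‖ ≤ ∑ i, ∑ j, |f (EuclideanSpace.single i 1) (EuclideanSpace.single j 1)| := by
  refine f.opNorm_le_bound₂ (by positivity) fun u v => ?_
  have h := abs_apply_le_sum_single ((f.flip v : EuclideanSpace ℝ (Fin p) →L[ℝ] ℝ) : _ →ₗ[ℝ] ℝ) u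
  simp only [ContinuousLinearMap.coe_coe, ContinuousLinearMap.flip_apply] at h
  refine h.trans ?_
  rw [mul_right_comm]
  refine mul_le_mul_of_nonneg_right ?_ (norm_nonneg _)
  rw [Finset.sum_mul]
  exact Finset.sum_le_sum fun i _ => abs_apply_le_sum_single (f _ : _ →ₗ[ℝ] ℝ) v

theorem abs_apply_le_sum_single₃ {p : ℕ}
    (A : EuclideanSpace ℝ (Fin p) →L[ℝ]
      ContinuousMultilinearMap ℝ (fun _ : Fin 2 => EuclideanSpace ℝ (Fin p)) ℝ)
    (w u v : EuclideanSpace ℝ (Fin p)) :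
    |A w ![u, v]| ≤ (∑ i, ∑ j, ∑ l, |A (EuclideanSpace.single i 1)
      ![EuclideanSpace.single j 1, EuclideanSpace.single l 1]|) * ‖w‖ * ‖u‖ * ‖v‖ := by
  let f : EuclideanSpace ℝ (Fin p) →ₗ[ℝ] ℝ :=
    { toFun := fun w => A w ![u, v], map_add' := by simp, map_smul' := by simp }
  -- Linearity in the inner slots is read off from the curried multilinear map, which avoids
  -- rewriting with `Function.update`.
  let g (w : EuclideanSpace ℝ (Fin p)) : EuclideanSpace ℝ (Fin p) →ₗ[ℝ] ℝ :=
    { toFun := fun u => A w ![u, v]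
      map_add' := fun x y => DFunLike.congr_fun ((A w).curryLeft.map_add x y) ![v]
      map_smul' := fun c x => DFunLike.congr_fun ((A w).curryLeft.map_smul c x) ![v] }
  let h (w u : EuclideanSpace ℝ (Fin p)) : EuclideanSpace ℝ (Fin p) →ₗ[ℝ] ℝ :=
    { toFun := fun v => A w ![u, v]
      map_add' := fun x y => DFunLike.congr_fun (((A w).curryLeft u).curryLeft.map_add x y) ![]
      map_smul' := fun c x => DFunLike.congr_fun (((A w).curryLeft u).curryLeft.map_smul c x) ![] }
  have hf : |A w ![u, v]| ≤ (∑ i, |A (EuclideanSpace.single i 1) ![u, v]|) * ‖w‖ :=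
    abs_apply_le_sum_single f w
  have hg (w) : |A w ![u, v]| ≤ (∑ i, |A w ![EuclideanSpace.single i 1, v]|) * ‖u‖ :=
    abs_apply_le_sum_single (g w) u
  have hh (w u) : |A w ![u, v]| ≤ (∑ i, |A w ![u, EuclideanSpace.single i 1]|) * ‖v‖ :=
    abs_apply_le_sum_single (h w u) v
  calc |A w ![u, v]| ≤ (∑ i, |A (EuclideanSpace.single i 1) ![u, v]|) * ‖w‖ := hf
    _ ≤ (∑ i, (∑ j, (∑ l, |A (EuclideanSpace.single i 1)
      ![EuclideanSpace.single j 1, EuclideanSpace.single l 1]|) * ‖v‖) * ‖u‖) * ‖w‖ := by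
        gcongr with i _
        refine (hg _).trans ?_
        gcongr with j _
        exact hh _ _
    _ = _ := by simp only [← Finset.sum_mul]; ring

theorem pd2_eq {p : ℕ} (f : EuclideanSpace ℝ (Fin p) → ℝ) (θ : EuclideanSpace ℝ (Fin p))
    (i j : Fin p) : pd2 f θ i j =
      fderiv ℝ (fderiv ℝ f) θ (EuclideanSpace.single i 1) (EuclideanSpace.single j 1) := by
  simp [pd2, iteratedFDeriv_two_apply]

/-! ### Functions with Lipschitz second derivative. -/

section Calculus

variable {E : Type*} [NormedAddCommGroup E] [NormedSpace ℝ E]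

/-- `f` is twice continuously differentiable at the points of `s`, and its second derivative is
Lipschitz on `s` with constant `m`. -/
def SecondDerivLipschitz (f : E → ℝ) (s : Set E) (m : ℝ) : Prop :=
  0 ≤ m ∧ (∀ x ∈ s, ContDiffAt ℝ 2 f x) ∧
  ∀ x ∈ s, ∀ y ∈ s, ‖fderiv ℝ (fderiv ℝ f) y - fderiv ℝ (fderiv ℝ f) x‖ ≤ m * ‖y - x‖

theorem SecondDerivLipschitz.mono_const {f : E → ℝ} {s : Set E} {m m' : ℝ}
    (h : SecondDerivLipschitz f s m) (hm : m ≤ m') : SecondDerivLipschitz f s m' :=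
  ⟨h.1.trans hm, h.2.1, fun x hx y hy => (h.2.2 x hx y hy).trans (by gcongr)⟩

theorem fderiv_weighted_sum {ι : Type*} {s : Finset ι} {c : ι → ℝ} {f : ι → E → ℝ} {x : E}
    (hf : ∀ i ∈ s, DifferentiableAt ℝ (f i) x) :
    fderiv ℝ (fun y => ∑ i ∈ s, c i * f i y) x = ∑ i ∈ s, c i • fderiv ℝ (f i) x := by
  rw [fderiv_fun_sum fun i hi => (hf i hi).const_mul (c i)]
  exact Finset.sum_congr rfl fun i hi => fderiv_const_mul (hf i hi) (c i)

theorem ContDiffAt.eventually_differentiableAt {f : E → ℝ} {x : E} (hf : ContDiffAt ℝ 2 f x) :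
    ∀ᶠ y in 𝓝 x, DifferentiableAt ℝ f y := by
  filter_upwards [hf.eventually (by simp)] with y hy
  exact hy.differentiableAt (by simp)

theorem ContDiffAt.differentiableAt_fderiv {f : E → ℝ} {x : E} (hf : ContDiffAt ℝ 2 f x) :
    DifferentiableAt ℝ (fderiv ℝ f) x :=
  (hf.fderiv_right (m := 1) (by norm_num)).differentiableAt (by simp)

theorem fderiv_fderiv_weighted_sum {ι : Type*} {s : Finset ι} {c : ι → ℝ} {f : ι → E → ℝ} {x : E}
    (hf : ∀ i ∈ s, ContDiffAt ℝ 2 (f i) x) :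
    fderiv ℝ (fderiv ℝ (fun y => ∑ i ∈ s, c i * f i y)) x =
      ∑ i ∈ s, c i • fderiv ℝ (fderiv ℝ (f i)) x := by
  -- The formula for the first derivative is needed on a neighbourhood, since it is differentiated
  -- once more.
  have h : fderiv ℝ (fun y => ∑ i ∈ s, c i * f i y) =ᶠ[𝓝 x]
      fun y => ∑ i ∈ s, c i • fderiv ℝ (f i) y := by
    have : ∀ᶠ y in 𝓝 x, ∀ i ∈ s, DifferentiableAt ℝ (f i) y :=
      (Filter.eventually_all_finset s).2 fun i hi =>
        ContDiffAt.eventually_differentiableAt (hf i hi)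
    filter_upwards [this] with y hy
    exact fderiv_weighted_sum hy
  have h' : ∀ i ∈ s, DifferentiableAt ℝ (fun y => c i • fderiv ℝ (f i) y) x := fun i hi =>
    (ContDiffAt.differentiableAt_fderiv (hf i hi)).const_smul (c i)
  rw [h.fderiv_eq, fderiv_fun_sum h']
  exact Finset.sum_congr rfl fun i hi =>
    fderiv_fun_const_smul (ContDiffAt.differentiableAt_fderiv (hf i hi)) (c i)

theorem SecondDerivLipschitz.weighted_sum {ι : Type*} {t : Finset ι} {c m : ι → ℝ}
    {f : ι → E → ℝ} {s : Set E} (hc : ∀ i ∈ t, 0 ≤ c i)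
    (hf : ∀ i ∈ t, SecondDerivLipschitz (f i) s (m i)) :
    SecondDerivLipschitz (fun x => ∑ i ∈ t, c i * f i x) s (∑ i ∈ t, c i * m i) := by
  refine ⟨Finset.sum_nonneg fun i hi => mul_nonneg (hc i hi) (hf i hi).1,
    fun x hx => ContDiffAt.sum fun i hi => contDiffAt_const.mul ((hf i hi).2.1 x hx),
    fun x hx y hy => ?_⟩
  rw [fderiv_fderiv_weighted_sum fun i hi => (hf i hi).2.1 x hx,
    fderiv_fderiv_weighted_sum fun i hi => (hf i hi).2.1 y hy, ← Finset.sum_sub_distrib,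
    Finset.sum_mul]
  refine (norm_sum_le t (fun i => c i • fderiv ℝ (fderiv ℝ (f i)) y -
    c i • fderiv ℝ (fderiv ℝ (f i)) x)).trans (Finset.sum_le_sum fun i hi => ?_)
  calc _ = c i * ‖fderiv ℝ (fderiv ℝ (f i)) y - fderiv ℝ (fderiv ℝ (f i)) x‖ := by
        rw [← smul_sub, norm_smul, Real.norm_of_nonneg (hc i hi)]
    _ ≤ c i * (m i * ‖y - x‖) := mul_le_mul_of_nonneg_left ((hf i hi).2.2 x hx y hy) (hc i hi)
    _ = _ := by ring

/-- On the segment the second derivative stays within `m * ‖y - x‖` of its value at `x`, so the mean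
value inequality applies to the gradient minus its linearization. The sharper factor `m / 2` is not
needed. -/
theorem SecondDerivLipschitz.norm_fderiv_sub_le {f : E → ℝ} {s : Set E} {m : ℝ}
    (hf : SecondDerivLipschitz f s m) (hs : Convex ℝ s) {x y : E} (hx : x ∈ s) (hy : y ∈ s) :
    ‖fderiv ℝ f y - fderiv ℝ f x - fderiv ℝ (fderiv ℝ f) x (y - x)‖ ≤ m * ‖y - x‖ ^ 2 := by
  have key := (convex_segment x y).norm_image_sub_le_of_norm_hasFDerivWithin_le'
    (f := fderiv ℝ f) (f' := fun z => fderiv ℝ (fderiv ℝ f) z)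
    (φ := fderiv ℝ (fderiv ℝ f) x) (C := m * ‖y - x‖)
    (fun z hz => (ContDiffAt.differentiableAt_fderiv
      (hf.2.1 z (hs.segment_subset hx hy hz))).hasFDerivAt.hasFDerivWithinAt)
    (fun z hz => (hf.2.2 x hx z (hs.segment_subset hx hy hz)).trans
      (mul_le_mul_of_nonneg_left (norm_sub_le_of_mem_segment hz) hf.1))
    (left_mem_segment ℝ x y) (right_mem_segment ℝ x y)
  refine key.trans_eq (by ring)

theorem SecondDerivLipschitz.symm {f : E → ℝ} {s : Set E} {m : ℝ}
    (hf : SecondDerivLipschitz f s m) {x : E} (hx : x ∈ s) (u v : E) :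
    fderiv ℝ (fderiv ℝ f) x u v = fderiv ℝ (fderiv ℝ f) x v u :=
  ((hf.2.1 x hx).isSymmSndFDerivAt (by simp)) u v

end Calculus

/-- For fixed `u` and `v` the second derivative becomes a real function whose derivative is
controlled by the third partials, so the mean value inequality applies. Mere existence of the third
derivative is enough; its continuity plays no role. -/
theorem secondDerivLipschitz_of_pd3_le {p : ℕ} {f : EuclideanSpace ℝ (Fin p) → ℝ}
    {s : Set (EuclideanSpace ℝ (Fin p))} (hs : Convex ℝ s) (hne : s.Nonempty)
    {m : Fin p → Fin p → Fin p → ℝ}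
    (h : ∀ θ ∈ s, ContDiffAt ℝ 2 f θ ∧ DifferentiableAt ℝ (iteratedFDeriv ℝ 2 f) θ ∧
      ∀ i j l, |pd3 f θ i j l| ≤ m i j l) :
    SecondDerivLipschitz f s (∑ i, ∑ j, ∑ l, m i j l) := by
  obtain ⟨θ₀, hθ₀⟩ := hne
  have hm : 0 ≤ ∑ i, ∑ j, ∑ l, m i j l :=
    Finset.sum_nonneg fun i _ => Finset.sum_nonneg fun j _ => Finset.sum_nonneg fun l _ =>
      (abs_nonneg _).trans ((h θ₀ hθ₀).2.2 i j l)
  refine ⟨hm, fun x hx => (h x hx).1, fun x hx y hy => ?_⟩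
  refine ContinuousLinearMap.opNorm_le_bound₂ _ (by positivity) fun u v => ?_
  let ev : ContinuousMultilinearMap ℝ (fun _ : Fin 2 => EuclideanSpace ℝ (Fin p)) ℝ →L[ℝ] ℝ :=
    ContinuousMultilinearMap.apply ℝ (fun _ : Fin 2 => EuclideanSpace ℝ (Fin p)) ℝ ![u, v]
  have key := hs.norm_image_sub_le_of_norm_hasFDerivWithin_le
    (f := fun z => ev (iteratedFDeriv ℝ 2 f z))
    (f' := fun z => ev.comp (fderiv ℝ (iteratedFDeriv ℝ 2 f) z))
    (C := (∑ i, ∑ j, ∑ l, m i j l) * ‖u‖ * ‖v‖)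
    (fun z hz => (ev.hasFDerivAt.comp z (h z hz).2.1.hasFDerivAt).hasFDerivWithinAt)
    (fun z hz => by
      refine ContinuousLinearMap.opNorm_le_bound _ (by positivity) fun w => ?_
      have h1 := abs_apply_le_sum_single₃ (fderiv ℝ (iteratedFDeriv ℝ 2 f) z) w u v
      refine h1.trans ?_
      have h2 : (∑ i, ∑ j, ∑ l, |fderiv ℝ (iteratedFDeriv ℝ 2 f) z (EuclideanSpace.single i 1)
          ![EuclideanSpace.single j 1, EuclideanSpace.single l 1]|) ≤ ∑ i, ∑ j, ∑ l, m i j l := by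
        gcongr with i _ j _ l _
        have h3 := (h z hz).2.2 i j l
        rwa [pd3, iteratedFDeriv_succ_apply_left] at h3
      calc _ ≤ (∑ i, ∑ j, ∑ l, m i j l) * ‖w‖ * ‖u‖ * ‖v‖ := by gcongr
        _ = _ := by ring) hx hy
  simp only [ev, ContinuousMultilinearMap.apply_apply, iteratedFDeriv_two_apply] at key
  simp only [sub_apply]
  refine key.trans_eq (by ring)

/-! ### Deterministic analysis of a quadratic form with a weighted `ℓ¹` penalty. -/

section Lasso

variable {p : ℕ} {T : Finset (Fin p)} {θ₀ : EuclideanSpace ℝ (Fin p)} {lam : Fin p → ℝ} {a b : ℝ}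

/-- The weighted `ℓ¹` penalty `∑ j, λ_j |θ₀_j + x_j|` at the displacement `x` from `θ₀`. -/
noncomputable def penalty (θ₀ : EuclideanSpace ℝ (Fin p)) (lam : Fin p → ℝ)
    (x : EuclideanSpace ℝ (Fin p)) : ℝ :=
  ∑ j, lam j * |θ₀ j + x j|

/-- The projection of a vector to the coordinates in `T`. -/
noncomputable def coordProj (T : Finset (Fin p)) (x : EuclideanSpace ℝ (Fin p)) :
    EuclideanSpace ℝ (Fin p) :=
  WithLp.toLp 2 fun j => if j ∈ T then x j else 0

theorem norm_le_sum_abs (x : EuclideanSpace ℝ (Fin p)) : ‖x‖ ≤ ∑ j, |x j| := by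
  have h : x = ∑ i, x i • EuclideanSpace.single i (1 : ℝ) := by
    simpa using ((EuclideanSpace.basisFun (Fin p) ℝ).sum_repr x).symm
  conv_lhs => rw [h]
  refine (norm_sum_le _ _).trans_eq (Finset.sum_congr rfl fun i _ => ?_)
  simp [norm_smul]

theorem abs_coord_le (x : EuclideanSpace ℝ (Fin p)) (j : Fin p) : |x j| ≤ ‖x‖ :=
  PiLp.norm_apply_le x j

/-- Only coordinates in `T` move, and the absolute value is 1-Lipschitz. -/
theorem penalty_add_smul_le (hlam : ∀ j, 0 ≤ lam j) (ha0 : 0 ≤ a) (ha : ∀ j ∈ T, lam j ≤ a)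
    {t : ℝ} (ht : 0 ≤ t) (x h : EuclideanSpace ℝ (Fin p)) (hh : ∀ j ∉ T, h j = 0) :
    penalty θ₀ lam (x + t • h) - penalty θ₀ lam x ≤ t * (p * a * ‖h‖) := by
  rw [penalty, penalty, ← Finset.sum_sub_distrib]
  calc _ ≤ ∑ _j : Fin p, t * (a * ‖h‖) := Finset.sum_le_sum fun j _ => ?_
    _ = _ := by simp; ring
  by_cases hj : j ∈ T
  · have h1 : |θ₀ j + (x + t • h) j| ≤ |θ₀ j + x j| + t * |h j| := by
      have := abs_add_le (θ₀ j + x j) (t * h j)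
      rw [abs_mul, abs_of_nonneg ht] at this
      simpa [add_assoc] using this
    calc _ ≤ lam j * (t * |h j|) := by
          rw [← mul_sub]; exact mul_le_mul_of_nonneg_left (by linarith) (hlam j)
      _ = t * (lam j * |h j|) := by ring
      _ ≤ t * (a * ‖h‖) := by
          gcongr
          · exact ha j hj
          · exact abs_coord_le h j
  · simp only [PiLp.add_apply, PiLp.smul_apply, hh j hj, smul_zero, add_zero, sub_self]
    positivity

/-- Off `T` the penalty at zero displacement vanishes with `θ₀`, so only coordinates in `T`, whose
weights are at most `a`, can favour `x`. -/
theorem penalty_zero_sub_le (hθ₀ : ∀ j ∉ T, θ₀ j = 0) (hlam : ∀ j, 0 ≤ lam j) (ha0 : 0 ≤ a)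
    (ha : ∀ j ∈ T, lam j ≤ a) (x : EuclideanSpace ℝ (Fin p)) :
    penalty θ₀ lam 0 - penalty θ₀ lam x ≤ p * a * ‖x‖ := by
  rw [penalty, penalty, ← Finset.sum_sub_distrib]
  calc _ ≤ ∑ _j : Fin p, (a * ‖x‖) := Finset.sum_le_sum fun j _ => ?_
    _ = _ := by simp; ring
  by_cases hj : j ∈ T
  · have h1 : |θ₀ j| ≤ |θ₀ j + x j| + |x j| := by
      have := abs_sub (θ₀ j + x j) (x j)
      simpa using this
    calc _ ≤ lam j * |x j| := by
          rw [← mul_sub]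
          exact mul_le_mul_of_nonneg_left (by simpa using by linarith) (hlam j)
      _ ≤ a * ‖x‖ := by
          gcongr
          · exact ha j hj
          · exact abs_coord_le x j
  · have := hlam j
    have : 0 ≤ lam j * |x j| := by positivity
    have : 0 ≤ a * ‖x‖ := by positivity
    simp only [hθ₀ j hj, PiLp.zero_apply, zero_add, abs_zero, mul_zero]
    linarith

/-- The projection keeps the terms in `T` and kills all others, each weighted by at least `b`; the
`ℓ¹` norm dominates the Euclidean one. -/
theorem le_penalty_sub_penalty_coordProj (hθ₀ : ∀ j ∉ T, θ₀ j = 0) (hb : ∀ j ∉ T, b ≤ lam j)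
    (hb0 : 0 ≤ b) (x : EuclideanSpace ℝ (Fin p)) :
    b * ‖x - coordProj T x‖ ≤ penalty θ₀ lam x - penalty θ₀ lam (coordProj T x) := by
  rw [penalty, penalty, ← Finset.sum_sub_distrib]
  calc _ ≤ b * ∑ j, |(x - coordProj T x) j| := by
        gcongr; exact norm_le_sum_abs _
    _ = ∑ j, b * |(x - coordProj T x) j| := Finset.mul_sum _ _ _
    _ ≤ _ := Finset.sum_le_sum fun j _ => ?_
  by_cases hj : j ∈ T
  · simp [coordProj, hj]
  · simp only [coordProj, PiLp.sub_apply, hj, if_false, sub_zero, hθ₀ j hj, zero_add, abs_zero,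
      mul_zero]
    gcongr
    exact hb j hj

variable {H : EuclideanSpace ℝ (Fin p) →L[ℝ] EuclideanSpace ℝ (Fin p) →L[ℝ] ℝ}
  {w : EuclideanSpace ℝ (Fin p) →L[ℝ] ℝ} {c C : ℝ} {x : EuclideanSpace ℝ (Fin p)}

/-- Compare `x` with `0`: coercivity makes the left side quadratic in `‖x‖`, while the linear form
and the penalty gain at most linearly. -/
theorem lasso_norm_le (hc : ∀ v, c * ‖v‖ ^ 2 ≤ H v v) (hθ₀ : ∀ j ∉ T, θ₀ j = 0)
    (hlam : ∀ j, 0 ≤ lam j) (ha0 : 0 ≤ a) (ha : ∀ j ∈ T, lam j ≤ a)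
    (hmin : ∀ z, H x x - 2 * w x + penalty θ₀ lam x ≤ H z z - 2 * w z + penalty θ₀ lam z) :
    c * ‖x‖ ≤ 2 * ‖w‖ + p * a := by
  rcases (norm_nonneg x).eq_or_lt with h0 | h0
  · rw [← h0]; simp; positivity
  have h1 := hmin 0
  have h2 := penalty_zero_sub_le hθ₀ hlam ha0 ha x
  have h3 := (le_abs_self _).trans (w.le_opNorm x)
  have h4 := hc x
  simp only [map_zero, mul_zero] at h1
  refine le_of_mul_le_mul_right ?_ h0
  nlinarith

/-- Compare `x` with its projection `y`. The penalty drops by at least `b * ‖x - y‖`, whereas the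
smooth part rises by at most `(2 * C * ‖x‖ + 2 * ‖w‖) * ‖x - y‖`, so minimality forces `x = y`. -/
theorem lasso_sparse (hsymm : ∀ u v, H u v = H v u) (hc0 : 0 ≤ c)
    (hc : ∀ v, c * ‖v‖ ^ 2 ≤ H v v) (hC : ‖H‖ ≤ C)
    (hθ₀ : ∀ j ∉ T, θ₀ j = 0) (hb : ∀ j ∉ T, b ≤ lam j)
    (hmin : ∀ z, H x x - 2 * w x + penalty θ₀ lam x ≤ H z z - 2 * w z + penalty θ₀ lam z)
    (hbig : 2 * C * ‖x‖ + 2 * ‖w‖ < b) : ∀ j ∉ T, x j = 0 := by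
  set y := coordProj T x with hy
  have hC0 : 0 ≤ C := (norm_nonneg _).trans hC
  have hb0 : 0 ≤ b := by
    have : 0 ≤ 2 * C * ‖x‖ + 2 * ‖w‖ := by positivity
    linarith
  have hxy : ‖x - y‖ = 0 := by
    by_contra hne
    have hpos : 0 < ‖x - y‖ := lt_of_le_of_ne (norm_nonneg _) (Ne.symm hne)
    have h1 := hmin y
    have h2 := le_penalty_sub_penalty_coordProj hθ₀ hb hb0 x
    rw [← hy] at h2
    have h3' : H x x - H y y = H (x - y) (x - y) + 2 * H y (x - y) := by
      simp only [map_sub, sub_apply, hsymm y x]; ring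
    have h4 : 0 ≤ H (x - y) (x - y) := le_trans (by positivity) (hc (x - y))
    have hyx : ‖y‖ ≤ ‖x‖ := by
      rw [EuclideanSpace.norm_eq, EuclideanSpace.norm_eq]
      refine Real.sqrt_le_sqrt (Finset.sum_le_sum fun j _ => ?_)
      by_cases hj : j ∈ T <;> simp [hy, coordProj, hj, sq_nonneg]
    have h5 : -(C * ‖x‖ * ‖x - y‖) ≤ H y (x - y) := by
      have := (neg_abs_le (H y (x - y)))
      have h6 : |H y (x - y)| ≤ C * ‖x‖ * ‖x - y‖ := by
        refine (H.le_opNorm₂ y (x - y)).trans ?_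
        gcongr
      linarith
    have h7 : w x - w y ≤ ‖w‖ * ‖x - y‖ := by
      rw [← map_sub]; exact (le_abs_self _).trans (w.le_opNorm _)
    nlinarith
  intro j hj
  have := abs_coord_le (x - y) j
  rw [hxy] at this
  have h0 : (x - y) j = 0 := abs_nonpos_iff.1 this
  simpa [hy, coordProj, hj] using h0

/-- One-sided directional derivative at the minimizer: step by `t • h`, divide by `t`, and let `t`
decrease to zero. Replacing the penalty by its Lipschitz bound avoids subgradients. -/
theorem lasso_first_order (hsymm : ∀ u v, H u v = H v u)
    (hlam : ∀ j, 0 ≤ lam j) (ha0 : 0 ≤ a) (ha : ∀ j ∈ T, lam j ≤ a)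
    (hmin : ∀ z, H x x - 2 * w x + penalty θ₀ lam x ≤ H z z - 2 * w z + penalty θ₀ lam z)
    (h : EuclideanSpace ℝ (Fin p)) (hh : ∀ j ∉ T, h j = 0) :
    0 ≤ 2 * (H x h - w h) + p * a * ‖h‖ := by
  have key : ∀ t : ℝ, 0 < t → 0 ≤ t * H h h + (2 * (H x h - w h) + p * a * ‖h‖) := by
    intro t ht
    have h1 := hmin (x + t • h)
    have h2 := penalty_add_smul_le (θ₀ := θ₀) hlam ha0 ha ht.le x h hh
    have h3 : H (x + t • h) (x + t • h) = H x x + 2 * t * H x h + t ^ 2 * H h h := by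
      simp only [map_add, map_smul, add_apply, smul_apply, smul_eq_mul, hsymm h x]; ring
    have h4 : w (x + t • h) = w x + t * w h := by simp
    rw [h3, h4] at h1
    refine le_of_mul_le_mul_left ?_ ht
    nlinarith
  have hlim : Tendsto (fun t : ℝ => t * H h h + (2 * (H x h - w h) + p * a * ‖h‖)) (𝓝[>] 0)
      (𝓝 (0 * H h h + (2 * (H x h - w h) + p * a * ‖h‖))) :=
    Tendsto.mono_left (by exact Continuous.tendsto (by fun_prop) 0) nhdsWithin_le_nhds
  rw [zero_mul, zero_add] at hlim
  exact ge_of_tendsto hlim (by filter_upwards [self_mem_nhdsWithin] with t ht using key t ht)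

/-- The distance between the Lasso minimizer `x` and an approximate solution `y` of the score
equation `L y = v` on the coordinates in `T`. -/
theorem lasso_dist_le (hsymm : ∀ u v, H u v = H v u) (hc0 : 0 ≤ c)
    (hc : ∀ v, c * ‖v‖ ^ 2 ≤ H v v) (hC : ‖H‖ ≤ C) (hθ₀ : ∀ j ∉ T, θ₀ j = 0)
    (hlam : ∀ j, 0 ≤ lam j) (ha0 : 0 ≤ a) (ha : ∀ j ∈ T, lam j ≤ a) (hb : ∀ j ∉ T, b ≤ lam j)
    (hmin : ∀ z, H x x - 2 * w x + penalty θ₀ lam x ≤ H z z - 2 * w z + penalty θ₀ lam z)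
    (hbig : 2 * C * ‖x‖ + 2 * ‖w‖ < b)
    {L : EuclideanSpace ℝ (Fin p) →L[ℝ] EuclideanSpace ℝ (Fin p) →L[ℝ] ℝ}
    {v : EuclideanSpace ℝ (Fin p) →L[ℝ] ℝ} {y : EuclideanSpace ℝ (Fin p)} {r : ℝ} (hr : 0 ≤ r)
    (hy : ∀ j ∉ T, y j = 0)
    (hscore : ∀ h, (∀ j ∉ T, h j = 0) → |L y h - v h| ≤ r * ‖h‖) :
    c * ‖y - x‖ ≤ ‖H - L‖ * ‖y‖ + r + ‖w - v‖ + p * a := by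
  rcases (norm_nonneg (y - x)).eq_or_lt with h0 | h0
  · rw [← h0]; simp; positivity
  have hx := lasso_sparse hsymm hc0 hc hC hθ₀ hb hmin hbig
  have hyx : ∀ j ∉ T, (y - x) j = 0 := fun j hj => by simp [hy j hj, hx j hj]
  -- In the direction `y - x`, inserting `L y` and `v` splits `H (y - x) (y - x)` into the operator
  -- difference, the residual of the score equation, the difference of the linear forms, and half of
  -- the penalty bound.
  have h1 := lasso_first_order hsymm hlam ha0 ha hmin (y - x) hyx
  have h2 := (le_abs_self _).trans (hscore (y - x) hyx)
  have h3 := (le_abs_self _).trans ((H - L).le_opNorm₂ y (y - x))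
  have h4 := (neg_abs_le _).trans' (neg_le_neg ((w - v).le_opNorm (y - x)))
  have h5 := hc (y - x)
  simp only [sub_apply, map_sub] at h1 h2 h3 h4 h5
  refine le_of_mul_le_mul_right ?_ h0
  have : 0 ≤ p * a * ‖y - x‖ := by positivity
  nlinarith

end Lasso

/-! ### Linearized score at a local minimizer. -/

section Worker

variable {E : Type*} [NormedAddCommGroup E] [NormedSpace ℝ E]

/-- At a critical point near `θ₀` the linearized score is quadratically small in the score at
`θ₀`. -/
theorem norm_score_add_hessian_le {f : E → ℝ} {s : Set E} {m c : ℝ}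
    (hf : SecondDerivLipschitz f s m) (hs : Convex ℝ s) {θ₀ θ : E} (hθ₀ : θ₀ ∈ s) (hθ : θ ∈ s)
    (hc0 : 0 < c) (hc : ∀ v, c * ‖v‖ ^ 2 ≤ fderiv ℝ (fderiv ℝ f) θ₀ v v)
    (hcrit : fderiv ℝ f θ = 0) (hclose : m * ‖θ - θ₀‖ ≤ c / 2) :
    ‖fderiv ℝ f θ₀ + fderiv ℝ (fderiv ℝ f) θ (θ - θ₀)‖ ≤ m * (4 / c ^ 2) * ‖fderiv ℝ f θ₀‖ ^ 2 := by
  set d := θ - θ₀ with hd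
  have h1 := hf.norm_fderiv_sub_le hs hθ hθ₀
  have h2 := hf.norm_fderiv_sub_le hs hθ₀ hθ
  have hm := hf.1
  have hd' : θ₀ - θ = -d := by simp [hd]
  rw [hcrit, hd', map_neg, sub_zero, sub_neg_eq_add, norm_neg] at h1
  rw [hcrit, ← hd, zero_sub, ← norm_neg, neg_sub, sub_neg_eq_add] at h2
  have h3 : c * ‖d‖ ≤ ‖fderiv ℝ (fderiv ℝ f) θ₀ d‖ := by
    rcases (norm_nonneg d).eq_or_lt with h0 | h0
    · rw [← h0]; simp
    refine le_of_mul_le_mul_right ?_ h0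
    have := (le_abs_self _).trans ((fderiv ℝ (fderiv ℝ f) θ₀ d).le_opNorm d)
    nlinarith [hc d]
  have h4 : ‖fderiv ℝ (fderiv ℝ f) θ₀ d‖ ≤ ‖fderiv ℝ f θ₀‖ + m * ‖d‖ ^ 2 := by
    have := norm_sub_le (fderiv ℝ (fderiv ℝ f) θ₀ d + fderiv ℝ f θ₀) (fderiv ℝ f θ₀)
    rw [add_sub_cancel_right] at this
    linarith
  -- Closeness makes the quadratic remainder at most `c / 2 * ‖d‖`, which is absorbed by coercivity.
  -- This localizes the critical point at the scale of the score.
  have h5 : ‖d‖ ≤ 2 / c * ‖fderiv ℝ f θ₀‖ := by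
    have : m * ‖d‖ ^ 2 ≤ c / 2 * ‖d‖ := by nlinarith [norm_nonneg d]
    rw [div_mul_eq_mul_div, le_div_iff₀ hc0]
    linarith
  calc _ ≤ m * ‖d‖ ^ 2 := h1
    _ ≤ m * (2 / c * ‖fderiv ℝ f θ₀‖) ^ 2 := by gcongr
    _ = _ := by ring

end Worker

theorem lam_le_aLam {p d₀ : ℕ} (lam : Fin p → ℝ) {j : Fin p} (hj : (j : ℕ) < d₀) :
    lam j ≤ aLam d₀ lam :=
  le_ciSup (f := fun j : {j : Fin p // (j : ℕ) < d₀} => lam j) (Set.finite_range _).bddAbove ⟨j, hj⟩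

theorem bLam_le_lam {p d₀ : ℕ} (lam : Fin p → ℝ) {j : Fin p} (hj : ¬ (j : ℕ) < d₀) :
    bLam d₀ lam ≤ lam j :=
  ciInf_le (f := fun j : {j : Fin p // ¬ (j : ℕ) < d₀} => lam j) (Set.finite_range _).bddBelow
    ⟨j, hj⟩

/-- A small move along `h` stays in the constraint set, because `s` is a neighbourhood and `h` is
supported on `T`. Fermat's rule in one variable then applies. -/
theorem fderiv_apply_eq_zero_of_isMinOn {p : ℕ} {f : EuclideanSpace ℝ (Fin p) → ℝ}
    {s : Set (EuclideanSpace ℝ (Fin p))} {T : Finset (Fin p)} {θ h : EuclideanSpace ℝ (Fin p)}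
    (hf : DifferentiableAt ℝ f θ) (hs : s ∈ 𝓝 θ) (hθ : ∀ j ∉ T, θ j = 0)
    (hmin : IsMinOn f {θ ∈ s | ∀ j ∉ T, θ j = 0} θ) (hh : ∀ j ∉ T, h j = 0) :
    fderiv ℝ f θ h = 0 := by
  have hcont : Tendsto (fun t : ℝ => θ + t • h) (𝓝 0) (𝓝 θ) := by
    have : Continuous fun t : ℝ => θ + t • h := by fun_prop
    simpa using this.tendsto 0
  have hloc : IsLocalMin (fun t : ℝ => f (θ + t • h)) 0 := by
    filter_upwards [hcont hs] with t ht
    simp only [zero_smul, add_zero]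
    exact hmin ⟨ht, fun j hj => by simp [hθ j hj, hh j hj]⟩
  have hderiv : HasDerivAt (fun t : ℝ => f (θ + t • h)) (fderiv ℝ f θ h) 0 := by
    have h1 : HasDerivAt (fun t : ℝ => θ + t • h) h 0 := by
      simpa using ((hasDerivAt_id (0 : ℝ)).smul_const h).const_add θ
    have h2 : HasFDerivAt f (fderiv ℝ f θ) (θ + (0 : ℝ) • h) := by simpa using hf.hasFDerivAt
    exact h2.comp_hasDerivAt (0 : ℝ) h1
  exact hloc.hasDerivAt_eq_zero hderiv

/-! ### The surrogate as a quadratic form, and its comparison with the global loss. -/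

namespace Model

variable {p : ℕ} {Ω : Type*} (S : Model p Ω) {N : ℕ} {ω : Ω}

/-- The average of `f` over the observations on worker `k`. -/
noncomputable def localMean (f : EuclideanSpace ℝ (Fin p) × ℝ → ℝ) (N : ℕ) (ω : Ω)
    (k : Fin (S.K N)) : ℝ :=
  (S.size N k : ℝ)⁻¹ * ∑ i ∈ S.block N k, f (S.Z N i ω)

theorem weight_nonneg (k : Fin (S.K N)) : 0 ≤ S.weight N k := by
  unfold weight; positivity

variable {S} in
theorem exists_worker_eq {k : Fin (S.K N)} (hk : 0 < S.size N k) : ∃ i, S.worker N i = k := by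
  obtain ⟨i, hi⟩ := Finset.card_pos.1 hk
  exact ⟨i, by simpa [block] using hi⟩

variable {S} in
theorem worker_of_mem_block {k : Fin (S.K N)} {i : Fin N} (hi : i ∈ S.block N k) :
    S.worker N i = k := by
  simpa [block] using hi

theorem sum_size : ∑ k, S.size N k = N := by
  have := Finset.card_eq_sum_card_fiberwise (s := (Finset.univ : Finset (Fin N)))
    (f := S.worker N) (t := Finset.univ) (fun _ _ => by simp)
  simpa [size, block] using this.symm

theorem sum_weight (hN : 0 < N) : ∑ k, S.weight N k = 1 := by
  have h : (∑ k, (S.size N k : ℝ)) = N := by exact_mod_cast S.sum_size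
  simp only [weight, ← Finset.sum_div, h]
  field_simp

theorem localLoss_eq_sum (k : Fin (S.K N)) : S.localLoss N ω k =
    fun θ => ∑ i ∈ S.block N k, (S.size N k : ℝ)⁻¹ * S.loss θ (S.Z N i ω) := by
  funext θ; simp [localLoss, Finset.mul_sum]

theorem globalLoss_eq_sum (hsize : ∀ k, 0 < S.size N k) : S.globalLoss N ω =
    fun θ => ∑ k, S.weight N k * S.localLoss N ω k θ := by
  funext θ
  have h (k : Fin (S.K N)) : S.weight N k * S.localLoss N ω k θ =
      (N : ℝ)⁻¹ * ∑ i ∈ S.block N k, S.loss θ (S.Z N i ω) := by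
    have : (S.size N k : ℝ) ≠ 0 := by exact_mod_cast (hsize k).ne'
    simp only [weight, localLoss]
    field_simp
  simp only [h, ← Finset.mul_sum, globalLoss, block]
  rw [Finset.sum_fiberwise]

theorem localHessian_apply (k : Fin (S.K N)) {θ : EuclideanSpace ℝ (Fin p)}
    (hsm : ∀ i, ContDiffAt ℝ 2 (fun θ' => S.loss θ' (S.Z N i ω)) θ) (a b : Fin p) :
    S.localHessian N ω k θ a b = fderiv ℝ (fderiv ℝ (S.localLoss N ω k)) θ
      (EuclideanSpace.single a 1) (EuclideanSpace.single b 1) := by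
  rw [localLoss_eq_sum, fderiv_fderiv_weighted_sum fun i _ => hsm i]
  simp [localHessian, pd2_eq, Finset.mul_sum]

theorem dotProduct_localHessian (k : Fin (S.K N)) {θ : EuclideanSpace ℝ (Fin p)}
    (hsm : ∀ i, ContDiffAt ℝ 2 (fun θ' => S.loss θ' (S.Z N i ω)) θ)
    (v : EuclideanSpace ℝ (Fin p)) :
    v.ofLp ⬝ᵥ (S.localHessian N ω k θ *ᵥ v.ofLp) =
      fderiv ℝ (fderiv ℝ (S.localLoss N ω k)) θ v v := by
  have h : v = ∑ i, v i • EuclideanSpace.single i (1 : ℝ) := by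
    simpa using ((EuclideanSpace.basisFun (Fin p) ℝ).sum_repr v).symm
  conv_rhs => rw [h]
  simp only [dotProduct, Matrix.mulVec, S.localHessian_apply k hsm, map_sum, map_smul, sum_apply,
    smul_apply, smul_eq_mul, Finset.mul_sum]
  rw [Finset.sum_comm]
  refine Finset.sum_congr rfl fun i _ => Finset.sum_congr rfl fun j _ => by ring

/-- Up to a constant, the least squares approximation is a quadratic function of the displacement
from any given point. -/
theorem lsaLoss_eq_quadratic {θhat : Fin (S.K N) → EuclideanSpace ℝ (Fin p)}
    (hsm : ∀ k i, ContDiffAt ℝ 2 (fun θ' => S.loss θ' (S.Z N i ω)) (θhat k))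
    (hsymm : ∀ k u v, fderiv ℝ (fderiv ℝ (S.localLoss N ω k)) (θhat k) u v =
      fderiv ℝ (fderiv ℝ (S.localLoss N ω k)) (θhat k) v u)
    (θ₀ : EuclideanSpace ℝ (Fin p)) :
    ∃ κ : ℝ, ∀ z, S.lsaLoss N ω θhat (θ₀ + z) =
      (∑ k, S.weight N k • fderiv ℝ (fderiv ℝ (S.localLoss N ω k)) (θhat k)) z z -
      2 * (∑ k, S.weight N k •
        fderiv ℝ (fderiv ℝ (S.localLoss N ω k)) (θhat k) (θhat k - θ₀)) z + κ := by
  refine ⟨∑ k, S.weight N k * fderiv ℝ (fderiv ℝ (S.localLoss N ω k)) (θhat k)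
    (θhat k - θ₀) (θhat k - θ₀), fun z => ?_⟩
  simp only [lsaLoss, S.dotProduct_localHessian _ (hsm _), sum_apply, smul_apply, smul_eq_mul,
    Finset.mul_sum]
  rw [← Finset.sum_sub_distrib, ← Finset.sum_add_distrib]
  refine Finset.sum_congr rfl fun k _ => ?_
  have h : θ₀ + z - θhat k = z - (θhat k - θ₀) := by abel
  rw [h]
  generalize θhat k - θ₀ = d at *
  simp only [map_sub, sub_apply, hsymm k z d]
  ring

theorem norm_weighted_sum_le {F : Type*} [SeminormedAddCommGroup F] [NormedSpace ℝ F] (hN : 0 < N)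
    {g : Fin (S.K N) → F} {r : ℝ} (hg : ∀ k, ‖g k‖ ≤ r) : ‖∑ k, S.weight N k • g k‖ ≤ r := by
  calc _ ≤ ∑ k, S.weight N k * r := norm_sum_le_of_le _ fun k _ => by
        rw [norm_smul, Real.norm_of_nonneg (S.weight_nonneg k)]
        exact mul_le_mul_of_nonneg_left (hg k) (S.weight_nonneg k)
    _ = r := by rw [← Finset.sum_mul, S.sum_weight hN, one_mul]

/-- Deterministic comparison of the shrinkage estimator with the oracle estimator. -/
theorem shrinkage_oracle_bounds (hN : 0 < N) (hsize : ∀ k : Fin (S.K N), 0 < S.size N k)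
    {T : Finset (Fin p)} (hθ₀ : ∀ j ∉ T, S.θ₀ j = 0) {δ ρ M c C a b : ℝ}
    (hball : Metric.closedBall S.θ₀ δ ⊆ S.Θ) (hρ0 : 0 ≤ ρ) (hρ : ρ < δ) (hc0 : 0 < c)
    (hMρ : M * ρ ≤ c / 2)
    (hsm : ∀ i, ∀ θ ∈ Metric.closedBall S.θ₀ δ, ContDiffAt ℝ 2 (fun θ' => S.loss θ' (S.Z N i ω)) θ)
    (hF : ∀ k, SecondDerivLipschitz (S.localLoss N ω k) (Metric.closedBall S.θ₀ δ) M)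
    (hc : ∀ k v, c * ‖v‖ ^ 2 ≤ fderiv ℝ (fderiv ℝ (S.localLoss N ω k)) S.θ₀ v v)
    (hC : ∀ k, ‖fderiv ℝ (fderiv ℝ (S.localLoss N ω k)) S.θ₀‖ ≤ C)
    {θhat : Fin (S.K N) → EuclideanSpace ℝ (Fin p)} (hθhat : ∀ k, ‖θhat k - S.θ₀‖ ≤ ρ)
    (hθhat_min : ∀ k, IsMinOn (S.localLoss N ω k) S.Θ (θhat k))
    {lam : Fin p → ℝ} (hlam : ∀ j, 0 ≤ lam j) (ha0 : 0 ≤ a) (ha : ∀ j ∈ T, lam j ≤ a)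
    (hb : ∀ j ∉ T, b ≤ lam j) {θlam θor : EuclideanSpace ℝ (Fin p)}
    (hθlam : IsMinOn (S.lassoObjective N ω θhat lam) Set.univ θlam)
    (hθor : ∀ j ∉ T, θor j = 0) (hθor_near : ‖θor - S.θ₀‖ < δ)
    (hθor_min : IsMinOn (S.globalLoss N ω) {θ ∈ S.Θ | ∀ j ∉ T, θ j = 0} θor) {g q : ℝ}
    (hg : ‖fderiv ℝ (S.globalLoss N ω) S.θ₀‖ ≤ g)
    (hq : M * (4 / c ^ 2) * ∑ k, S.weight N k * ‖fderiv ℝ (S.localLoss N ω k) S.θ₀‖ ^ 2 ≤ q) :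
    c / 2 * ‖θlam - S.θ₀‖ ≤ 2 * (g + q) + p * a ∧
    (2 * (C + c / 2) * ‖θlam - S.θ₀‖ + 2 * (g + q) < b →
      c / 2 * ‖θor - θlam‖ ≤ M * ρ * ‖θor - S.θ₀‖ + M * ‖θor - S.θ₀‖ ^ 2 + q + p * a) := by
  have hδ : 0 < δ := hρ0.trans_lt hρ
  set s := Metric.closedBall S.θ₀ δ with hs
  have hsc : Convex ℝ s := convex_closedBall _ _
  have h0s : S.θ₀ ∈ s := Metric.mem_closedBall_self hδ.le
  have hnhds (θ : EuclideanSpace ℝ (Fin p)) (hθ : ‖θ - S.θ₀‖ < δ) : θ ∈ s ∧ S.Θ ∈ 𝓝 θ := by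
    rw [← dist_eq_norm] at hθ
    exact ⟨hθ.le, mem_of_superset (Metric.isOpen_ball.mem_nhds hθ)
      (Metric.ball_subset_closedBall.trans hball)⟩
  have hhat (k) := hnhds (θhat k) ((hθhat k).trans_lt hρ)
  -- A worker exists because there is an observation; its Lipschitz constant shows `0 ≤ M`.
  have hKpos : ∃ k : Fin (S.K N), True := ⟨S.worker N ⟨0, hN⟩, trivial⟩
  have hM0 : 0 ≤ M := (hF hKpos.choose).1
  let B (k : Fin (S.K N)) := fderiv ℝ (fderiv ℝ (S.localLoss N ω k)) (θhat k)
  let B₀ (k : Fin (S.K N)) := fderiv ℝ (fderiv ℝ (S.localLoss N ω k)) S.θ₀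
  let G (k : Fin (S.K N)) := fderiv ℝ (S.localLoss N ω k) S.θ₀
  have hBsymm (k u v) : B k u v = B k v u := (hF k).symm (hhat k).1 u v
  have hBB (k) : ‖B k - B₀ k‖ ≤ M * ρ :=
    ((hF k).2.2 _ h0s _ (hhat k).1).trans (by gcongr; exact hθhat k)
  -- Moving the Hessian from `θ₀` to `θhat k` costs at most `M * ρ ≤ c / 2` of the ellipticity.
  have hBc (k v) : c / 2 * ‖v‖ ^ 2 ≤ B k v v := by
    have h1 := (neg_abs_le _).trans' (neg_le_neg ((B k - B₀ k).le_opNorm₂ v v))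
    have h2 : ‖B k - B₀ k‖ * ‖v‖ * ‖v‖ ≤ c / 2 * ‖v‖ * ‖v‖ := by
      gcongr; exact (hBB k).trans hMρ
    have h3 := hc k v
    simp only [sub_apply] at h1
    change c * ‖v‖ ^ 2 ≤ B₀ k v v at h3
    nlinarith
  have hBC (k) : ‖B k‖ ≤ C + c / 2 := by
    have := norm_add_le (B₀ k) (B k - B₀ k)
    rw [add_sub_cancel] at this
    linarith [hC k, hBB k]
  have hcrit (k) : fderiv ℝ (S.localLoss N ω k) (θhat k) = 0 :=
    ((hθhat_min k).isLocalMin (hhat k).2).fderiv_eq_zero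
  set H := ∑ k, S.weight N k • B k with hH
  set w := ∑ k, S.weight N k • B k (θhat k - S.θ₀) with hw
  set L := ∑ k, S.weight N k • B₀ k with hL
  have hGl : S.globalLoss N ω = fun θ => ∑ k, S.weight N k * S.localLoss N ω k θ :=
    S.globalLoss_eq_sum hsize
  have hglob : SecondDerivLipschitz (S.globalLoss N ω) s M := by
    have h1 := SecondDerivLipschitz.weighted_sum (t := Finset.univ) (c := S.weight N)
      (m := fun _ => M) (fun k _ => S.weight_nonneg k) (fun k _ => hF k)
    rw [hGl]
    simpa [← Finset.sum_mul, S.sum_weight hN] using h1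
  have hDglob : fderiv ℝ (S.globalLoss N ω) S.θ₀ = ∑ k, S.weight N k • G k := by
    rw [hGl, fderiv_weighted_sum fun k _ => ((hF k).2.1 _ h0s).differentiableAt (by simp)]
  have hD2glob : fderiv ℝ (fderiv ℝ (S.globalLoss N ω)) S.θ₀ = L := by
    rw [hGl, fderiv_fderiv_weighted_sum fun k _ => (hF k).2.1 _ h0s]
  have hHsymm (u v) : H u v = H v u := by
    simp only [hH, sum_apply, smul_apply, hBsymm _ u v]
  have hHc (v) : c / 2 * ‖v‖ ^ 2 ≤ H v v := by
    simp only [hH, sum_apply, smul_apply, smul_eq_mul]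
    calc c / 2 * ‖v‖ ^ 2 = ∑ k, S.weight N k * (c / 2 * ‖v‖ ^ 2) := by
          rw [← Finset.sum_mul, S.sum_weight hN, one_mul]
      _ ≤ _ := Finset.sum_le_sum fun k _ => mul_le_mul_of_nonneg_left (hBc k v) (S.weight_nonneg k)
  have hHC : ‖H‖ ≤ C + c / 2 := S.norm_weighted_sum_le hN hBC
  have hHL : ‖H - L‖ ≤ M * ρ := by
    rw [hH, hL, ← Finset.sum_sub_distrib]
    simp only [← smul_sub]
    exact S.norm_weighted_sum_le hN hBB
  -- The averaged local scores form the global score, so the linear form `w` differs from minus that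
  -- score only by the averaged quadratic remainders.
  have hwv : ‖w + fderiv ℝ (S.globalLoss N ω) S.θ₀‖ ≤ q := by
    refine le_trans ?_ hq
    rw [hw, hDglob, ← Finset.sum_add_distrib, Finset.mul_sum]
    refine norm_sum_le_of_le _ fun k _ => ?_
    rw [← smul_add, norm_smul, Real.norm_of_nonneg (S.weight_nonneg k), add_comm]
    have := norm_score_add_hessian_le (hF k) hsc h0s (hhat k).1 hc0 (hc k) (hcrit k)
      ((mul_le_mul_of_nonneg_left (hθhat k) hM0).trans hMρ)
    calc _ ≤ S.weight N k * (M * (4 / c ^ 2) * ‖fderiv ℝ (S.localLoss N ω k) S.θ₀‖ ^ 2) :=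
          mul_le_mul_of_nonneg_left this (S.weight_nonneg k)
      _ = _ := by ring
  have hwn : ‖w‖ ≤ g + q := by
    have := norm_sub_le (w + fderiv ℝ (S.globalLoss N ω) S.θ₀) (fderiv ℝ (S.globalLoss N ω) S.θ₀)
    rw [add_sub_cancel_right] at this
    linarith
  set x := θlam - S.θ₀ with hx
  set y := θor - S.θ₀ with hy
  obtain ⟨κ, hκ⟩ := S.lsaLoss_eq_quadratic (fun k i => hsm i _ (hhat k).1) hBsymm S.θ₀
  have hmin (z) : H x x - 2 * w x + penalty S.θ₀ lam x ≤ H z z - 2 * w z + penalty S.θ₀ lam z := by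
    have h1 : S.lassoObjective N ω θhat lam θlam ≤ S.lassoObjective N ω θhat lam (S.θ₀ + z) :=
      hθlam (Set.mem_univ _)
    have h2 : θlam = S.θ₀ + x := by simp [hx]
    rw [h2] at h1
    simp only [lassoObjective, hκ] at h1
    simp only [penalty]
    change H x x - 2 * w x + κ + _ ≤ H z z - 2 * w z + κ + _ at h1
    simp only [PiLp.add_apply] at h1
    linarith
  have hc2 : 0 ≤ c / 2 := by positivity
  have hq0 : 0 ≤ q := (norm_nonneg _).trans hwv
  refine ⟨(lasso_norm_le hHc hθ₀ hlam ha0 ha hmin).trans (by linarith), fun hbig => ?_⟩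
  -- The oracle is critical along directions supported on `T`, so expanding the global score at `θ₀`
  -- gives `L y = -∇L(θ₀)` there, with residual `M * ‖y‖ ^ 2`.
  have hscore : ∀ h : EuclideanSpace ℝ (Fin p), (∀ j ∉ T, h j = 0) →
      |L y h - (-fderiv ℝ (S.globalLoss N ω) S.θ₀) h| ≤ M * ‖y‖ ^ 2 * ‖h‖ := by
    intro h hh
    have hor := hnhds θor hθor_near
    have h1 := hglob.norm_fderiv_sub_le hsc h0s hor.1
    have h2 : fderiv ℝ (S.globalLoss N ω) θor h = 0 :=
      fderiv_apply_eq_zero_of_isMinOn ((hglob.2.1 _ hor.1).differentiableAt (by simp)) hor.2 hθor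
        hθor_min hh
    rw [hD2glob] at h1
    have h3 := ContinuousLinearMap.le_of_opNorm_le _ h1 h
    simp only [sub_apply, h2] at h3
    rw [neg_apply, ← abs_neg]
    refine le_trans (le_of_eq ?_) h3
    rw [Real.norm_eq_abs]
    congr 1
    ring
  have hy0 : ∀ j ∉ T, y j = 0 := fun j hj => by simp [hy, hθor j hj, hθ₀ j hj]
  have hyx : θor - θlam = y - x := by simp [hx, hy]
  rw [hyx]
  have hbig' : 2 * (C + c / 2) * ‖x‖ + 2 * ‖w‖ < b := by linarith
  refine (lasso_dist_le hHsymm hc2 hHc hHC hθ₀ hlam ha0 ha hb hmin hbig' (by positivity) hy0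
    hscore).trans ?_
  rw [sub_neg_eq_add]
  have : ‖H - L‖ * ‖y‖ ≤ M * ρ * ‖y‖ := by gcongr
  linarith

end Model

/-! ### High probability events and boundedness in probability. -/

section WithHighProb

variable {Ω : Type*} [MeasurableSpace Ω] {P : Measure Ω} {A B : ℕ → Ω → Prop}

theorem WithHighProb.mono (h : WithHighProb P A) (hAB : ∀ᶠ N in atTop, ∀ ω, A N ω → B N ω) :
    WithHighProb P B := by
  refine tendsto_of_tendsto_of_tendsto_of_le_of_le' tendsto_const_nhds h
    (Eventually.of_forall fun _ => zero_le) ?_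
  filter_upwards [hAB] with N hN
  exact measure_mono fun ω hω hA => hω (hN ω hA)

theorem WithHighProb.and (hA : WithHighProb P A) (hB : WithHighProb P B) :
    WithHighProb P fun N ω => A N ω ∧ B N ω := by
  have h : Tendsto (fun N => P {ω | ¬ A N ω} + P {ω | ¬ B N ω}) atTop (𝓝 0) := by
    simpa using Tendsto.add hA hB
  refine tendsto_of_tendsto_of_tendsto_of_le_of_le tendsto_const_nhds h
    (fun _ => zero_le) fun N => ?_
  refine (measure_mono fun ω hω => ?_).trans (measure_union_le _ _)
  exact not_and_or.1 hω

theorem withHighProb_of_eventually_ae (h : ∀ᶠ N in atTop, ∀ᵐ ω ∂P, A N ω) : WithHighProb P A :=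
  tendsto_const_nhds.congr' (by filter_upwards [h] with N hN using (ae_iff.1 hN).symm)

theorem withHighProb_of_le {r : ℕ → ℝ} (hr : Tendsto r atTop (𝓝 0))
    (h : ∀ᶠ N in atTop, P {ω | ¬ A N ω} ≤ ENNReal.ofReal (r N)) : WithHighProb P A :=
  tendsto_of_tendsto_of_tendsto_of_le_of_le' tendsto_const_nhds
    (by simpa using ENNReal.tendsto_ofReal hr) (Eventually.of_forall fun _ => zero_le) h

theorem withHighProb_forall {ι : Type*} [Fintype ι] {A : ι → ℕ → Ω → Prop}
    (h : ∀ i, WithHighProb P (A i)) : WithHighProb P fun N ω => ∀ i, A i N ω := by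
  have hsum : Tendsto (fun N => ∑ i, P {ω | ¬ A i N ω}) atTop (𝓝 0) := by
    simpa using tendsto_finsetSum Finset.univ fun i _ => h i
  refine tendsto_of_tendsto_of_tendsto_of_le_of_le tendsto_const_nhds hsum
    (fun _ => zero_le) fun N => ?_
  refine (measure_mono fun ω hω => ?_).trans (measure_iUnion_fintype_le P fun i => {ω | ¬ A i N ω})
  obtain ⟨i, hi⟩ := not_forall.1 hω
  exact Set.mem_iUnion.2 ⟨i, hi⟩

/-- The sequence `X` is bounded above in probability. -/
def BoundedInProb (P : Measure Ω) (X : ℕ → Ω → ℝ) : Prop :=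
  ∀ ε : ℝ≥0∞, 0 < ε → ∃ R : ℝ, ∀ᶠ N in atTop, P {ω | ¬ X N ω ≤ R} ≤ ε

theorem boundedInProb_sum {ι : Type*} [Fintype ι] {X : ι → ℕ → Ω → ℝ}
    (h : ∀ i, BoundedInProb P (X i)) : BoundedInProb P fun N ω => ∑ i, X i N ω := by
  intro ε hε
  rcases isEmpty_or_nonempty ι with hι | hι
  · exact ⟨0, by simp⟩
  have hcard : (Fintype.card ι : ℝ≥0∞) ≠ 0 := by simp
  choose R hR using fun i => h i (ε / Fintype.card ι)
    (ENNReal.div_pos hε.ne' (ENNReal.natCast_ne_top _))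
  refine ⟨∑ i, R i, ?_⟩
  filter_upwards [eventually_all.2 hR] with N hN
  calc P {ω | ¬ ∑ i, X i N ω ≤ ∑ i, R i} ≤ P (⋃ i, {ω | ¬ X i N ω ≤ R i}) := by
        refine measure_mono fun ω hω => ?_
        by_contra hcon
        simp only [Set.mem_iUnion, Set.mem_ofPred_eq, not_exists, not_not] at hcon
        exact hω (Finset.sum_le_sum fun i _ => hcon i)
    _ ≤ ∑ i, P {ω | ¬ X i N ω ≤ R i} := measure_iUnion_fintype_le _ _
    _ ≤ ∑ _i : ι, ε / Fintype.card ι := Finset.sum_le_sum fun i _ => hN i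
    _ = ε := by
      rw [Finset.sum_const, Finset.card_univ, nsmul_eq_mul,
        ENNReal.mul_div_cancel hcard (ENNReal.natCast_ne_top _)]

theorem BoundedInProb.mono {X Y : ℕ → Ω → ℝ} (hX : BoundedInProb P X)
    (h : WithHighProb P fun N ω => Y N ω ≤ X N ω) : BoundedInProb P Y := by
  intro ε hε
  have hε2 : 0 < ε / 2 := ENNReal.half_pos hε.ne'
  obtain ⟨R, hR⟩ := hX (ε / 2) hε2
  refine ⟨R, ?_⟩
  filter_upwards [hR, ENNReal.tendsto_nhds_zero.1 h _ hε2] with N h1 h2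
  calc P {ω | ¬ Y N ω ≤ R} ≤ P ({ω | ¬ X N ω ≤ R} ∪ {ω | ¬ Y N ω ≤ X N ω}) := by
        refine measure_mono fun ω hω => ?_
        by_contra hcon
        simp only [Set.mem_union, Set.mem_ofPred_eq, not_or, not_not] at hcon
        exact hω (hcon.2.trans hcon.1)
    _ ≤ ε / 2 + ε / 2 := (measure_union_le _ _).trans (add_le_add h1 h2)
    _ = ε := ENNReal.add_halves ε

/-- If, on the event that `X` is bounded by `R`, the property `A` holds with high probability for
every `R`, and `X` is bounded in probability, then `A` holds with high probability. -/
theorem BoundedInProb.withHighProb {X : ℕ → Ω → ℝ} (hX : BoundedInProb P X)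
    (h : ∀ R : ℝ, WithHighProb P fun N ω => X N ω ≤ R → A N ω) : WithHighProb P A := by
  refine ENNReal.tendsto_nhds_zero.2 fun ε hε => ?_
  have hε2 : 0 < ε / 2 := ENNReal.half_pos hε.ne'
  obtain ⟨R, hR⟩ := hX (ε / 2) hε2
  filter_upwards [hR, ENNReal.tendsto_nhds_zero.1 (h R) _ hε2] with N h1 h2
  calc P {ω | ¬ A N ω} ≤ P ({ω | ¬ X N ω ≤ R} ∪ {ω | ¬ (X N ω ≤ R → A N ω)}) := by
        refine measure_mono fun ω hω => ?_
        by_contra hcon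
        simp only [Set.mem_union, Set.mem_ofPred_eq, not_or, not_not] at hcon
        exact hω (hcon.2 hcon.1)
    _ ≤ ε / 2 + ε / 2 := (measure_union_le _ _).trans (add_le_add h1 h2)
    _ = ε := ENNReal.add_halves ε

/-- A sequence converging in distribution is bounded in probability. -/
theorem boundedInProb_norm_of_tendstoInDistribution {Ω' E : Type*} [MeasurableSpace Ω']
    [NormedAddCommGroup E] [MeasurableSpace E] [BorelSpace E] [IsProbabilityMeasure P]
    {μ : Measure Ω'} [IsProbabilityMeasure μ] {X : ℕ → Ω → E} {Z : Ω' → E}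
    (h : TendstoInDistribution X atTop Z (fun _ => P) μ) :
    BoundedInProb P fun N ω => ‖X N ω‖ := by
  intro ε hε
  set ν := μ.map Z with hν
  have : IsProbabilityMeasure ν := Measure.isProbabilityMeasure_map h.aemeasurable_limit
  have hanti : Antitone fun n : ℕ => {x : E | (n : ℝ) ≤ ‖x‖} := fun a b hab x (hx : (b : ℝ) ≤ ‖x‖) =>
    show (a : ℝ) ≤ ‖x‖ from le_trans (by exact_mod_cast hab) hx
  have hclosed (n : ℕ) : IsClosed {x : E | (n : ℝ) ≤ ‖x‖} :=
    isClosed_le continuous_const continuous_norm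
  have hlim := tendsto_measure_iInter_atTop (μ := ν)
    (fun n => (hclosed n).measurableSet.nullMeasurableSet) hanti ⟨0, measure_ne_top _ _⟩
  have hempty : ⋂ n : ℕ, {x : E | (n : ℝ) ≤ ‖x‖} = ∅ := by
    refine Set.eq_empty_of_forall_notMem fun x hx => ?_
    obtain ⟨n, hn⟩ := exists_nat_gt ‖x‖
    exact absurd (Set.mem_iInter.1 hx n) (not_le.2 hn)
  rw [hempty, measure_empty] at hlim
  obtain ⟨n, hn⟩ := (hlim.eventually (gt_mem_nhds hε)).exists
  refine ⟨n, ?_⟩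
  -- The portmanteau inequality for closed sets carries the tail bound of the limit law over to all
  -- large `N`.
  have hlimsup := ProbabilityMeasure.limsup_measure_closed_le_of_tendsto h.tendsto (hclosed n)
  have hev := eventually_lt_of_limsup_lt (hlimsup.trans_lt hn)
  filter_upwards [hev] with N hN
  refine le_trans (measure_mono ?_) (le_trans (le_of_eq
    (Measure.map_apply_of_aemeasurable (h.forall_aemeasurable N)
      (hclosed n).measurableSet).symm) hN.le)
  intro ω hω
  exact (not_le.1 hω).le

end WithHighProb

/-! ### Moments and Chebyshev bounds for local averages. -/

namespace Model

variable {p : ℕ} {Ω : Type*} [MeasurableSpace Ω] {P : Measure Ω} {S : Model p Ω} {N : ℕ}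

variable {f : EuclideanSpace ℝ (Fin p) × ℝ → ℝ}

theorem Sampling.integral_comp (hs : S.Sampling P) (i : Fin N)
    (hf : AEStronglyMeasurable f (S.law (S.worker N i))) :
    ∫ ω, f (S.Z N i ω) ∂P = ∫ z, f z ∂(S.law (S.worker N i)) := by
  rw [← (hs N).2.2 i] at hf ⊢
  exact (integral_map ((hs N).1 i).aemeasurable hf).symm

theorem Sampling.integrable_comp (hs : S.Sampling P) (i : Fin N)
    (hf : Integrable f (S.law (S.worker N i))) : Integrable (fun ω => f (S.Z N i ω)) P := by
  rw [← (hs N).2.2 i] at hf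
  exact hf.comp_measurable ((hs N).1 i)

theorem Sampling.memLp_comp (hs : S.Sampling P) (i : Fin N)
    (hf : MemLp f 2 (S.law (S.worker N i))) : MemLp (fun ω => f (S.Z N i ω)) 2 P := by
  rw [← (hs N).2.2 i] at hf
  exact hf.comp_of_map ((hs N).1 i).aemeasurable

theorem Sampling.memLp_sum (hs : S.Sampling P) {s : Finset (Fin N)}
    (hf : ∀ i ∈ s, MemLp f 2 (S.law (S.worker N i))) :
    MemLp (fun ω => ∑ i ∈ s, f (S.Z N i ω)) 2 P :=
  memLp_finsetSum s fun i hi => hs.memLp_comp i (hf i hi)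

theorem Sampling.integral_localMean (hs : S.Sampling P) {k : Fin (S.K N)} (hk : 0 < S.size N k)
    (hf : Integrable f (S.law k)) : ∫ ω, S.localMean f N ω k ∂P = ∫ z, f z ∂(S.law k) := by
  have hk' : (S.size N k : ℝ) ≠ 0 := by exact_mod_cast hk.ne'
  simp only [localMean]
  rw [integral_const_mul, integral_finsetSum]
  · rw [Finset.sum_congr rfl (g := fun _ => ∫ z, f z ∂(S.law k))]
    · rw [Finset.sum_const, nsmul_eq_mul]
      change _ * ((S.size N k : ℝ) * _) = _
      field_simp
    · intro i hi
      rw [hs.integral_comp i (by rw [worker_of_mem_block hi]; exact hf.1), worker_of_mem_block hi]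
  · intro i hi
    exact hs.integrable_comp i (by rwa [worker_of_mem_block hi])

theorem Sampling.memLp_localMean (hs : S.Sampling P) {k : Fin (S.K N)}
    (hf : MemLp f 2 (S.law k)) : MemLp (fun ω => S.localMean f N ω k) 2 P :=
  (hs.memLp_sum fun i hi => by rwa [worker_of_mem_block hi]).const_mul _

theorem Sampling.integrable_localMean (hs : S.Sampling P) {k : Fin (S.K N)}
    (hf : Integrable f (S.law k)) : Integrable (fun ω => S.localMean f N ω k) P := by
  refine Integrable.const_mul (integrable_finsetSum _ fun i hi => ?_) _
  exact hs.integrable_comp i (by rwa [worker_of_mem_block hi])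

variable [IsProbabilityMeasure P]

theorem Sampling.isProbabilityMeasure_law (hs : S.Sampling P) (i : Fin N) :
    IsProbabilityMeasure (S.law (S.worker N i)) := by
  rw [← (hs N).2.2 i]
  exact Measure.isProbabilityMeasure_map ((hs N).1 i).aemeasurable

/-- Independence makes the variance additive, and each variance is at most the second moment.
Different laws on different workers are allowed. -/
theorem Sampling.variance_sum_le (hs : S.Sampling P) {s : Finset (Fin N)} {v : ℝ}
    (hf : ∀ i ∈ s, MemLp f 2 (S.law (S.worker N i)))
    (hv : ∀ i ∈ s, ∫ z, f z ^ 2 ∂(S.law (S.worker N i)) ≤ v) :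
    Var[fun ω => ∑ i ∈ s, f (S.Z N i ω); P] ≤ s.card * v := by
  have h1 : (fun ω => ∑ i ∈ s, f (S.Z N i ω)) = ∑ i ∈ s, fun ω => f (S.Z N i ω) := by
    funext ω; simp
  rw [h1, IndepFun.variance_sum fun i hi => hs.memLp_comp i (hf i hi)]
  · calc _ ≤ ∑ _i ∈ s, v := Finset.sum_le_sum fun i hi => ?_
      _ = _ := by simp
    refine (variance_le_expectation_sq (hs.memLp_comp i (hf i hi)).1).trans ?_
    refine le_trans (le_of_eq ?_) (hv i hi)
    exact hs.integral_comp (f := fun z => f z ^ 2) i ((hf i hi).1.pow 2)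
  · intro i hi j hj hij
    refine ((hs N).2.1.indepFun hij).comp₀ ((hs N).1 i).aemeasurable ((hs N).1 j).aemeasurable ?_ ?_
    · rw [(hs N).2.2 i]; exact (hf i hi).1.aemeasurable
    · rw [(hs N).2.2 j]; exact (hf j hj).1.aemeasurable

theorem Sampling.variance_localMean_le (hs : S.Sampling P) {k : Fin (S.K N)} (hk : 0 < S.size N k)
    {v : ℝ} (hf : MemLp f 2 (S.law k)) (hv : ∫ z, f z ^ 2 ∂(S.law k) ≤ v) :
    Var[fun ω => S.localMean f N ω k; P] ≤ v / S.size N k := by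
  have hk' : (0 : ℝ) < S.size N k := by exact_mod_cast hk
  have h := hs.variance_sum_le (f := f) (s := S.block N k) (v := v)
    (fun i hi => by rwa [worker_of_mem_block hi]) (fun i hi => by rwa [worker_of_mem_block hi])
  simp only [localMean]
  rw [variance_const_mul]
  calc _ ≤ (S.size N k : ℝ)⁻¹ ^ 2 * (S.size N k * v) := by
        gcongr; exact h
    _ = _ := by field_simp

theorem Sampling.measure_localMean_ge_le (hs : S.Sampling P) {k : Fin (S.K N)}
    (hk : 0 < S.size N k) {v ε : ℝ} (hε : 0 < ε) (hf : MemLp f 2 (S.law k))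
    (hv : ∫ z, f z ^ 2 ∂(S.law k) ≤ v) :
    P {ω | ε ≤ |S.localMean f N ω k - ∫ z, f z ∂(S.law k)|} ≤
      ENNReal.ofReal (v / ε ^ 2 * (S.size N k : ℝ)⁻¹) := by
  -- `law k` is known to be a probability measure through an observation that follows it.
  obtain ⟨i, hi⟩ := exists_worker_eq hk
  have : IsProbabilityMeasure (S.law k) := hi ▸ hs.isProbabilityMeasure_law i
  have h := meas_ge_le_variance_div_sq (hs.memLp_localMean hf) hε
  rw [hs.integral_localMean hk (hf.integrable (by norm_num))] at h
  refine h.trans (ENNReal.ofReal_le_ofReal ?_)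
  calc _ ≤ v / S.size N k / ε ^ 2 := by
        gcongr; exact hs.variance_localMean_le hk hf hv
    _ = _ := by ring

end Model

theorem integral_sq_le_of_eLpNorm_le {α : Type*} [MeasurableSpace α] {μ : Measure α} {f : α → ℝ}
    {C : ℝ≥0} (hf : AEStronglyMeasurable f μ) (h : eLpNorm f 2 μ ≤ C) :
    ∫ z, f z ^ 2 ∂μ ≤ (C : ℝ) ^ 2 := by
  rw [integral_eq_lintegral_of_nonneg_ae (ae_of_all _ fun z => sq_nonneg _) (hf.pow 2)]
  refine ENNReal.toReal_le_of_le_ofReal (by positivity) ?_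
  have h1 := eLpNorm_nnreal_pow_eq_lintegral (f := f) (μ := μ) (p := 2) (by norm_num)
  have h2 : ∫⁻ z, ENNReal.ofReal (f z ^ 2) ∂μ = ∫⁻ z, ‖f z‖ₑ ^ ((2 : ℝ≥0) : ℝ) ∂μ := by
    refine lintegral_congr fun z => ?_
    rw [← ofReal_norm, ENNReal.ofReal_rpow_of_nonneg (norm_nonneg _) (by norm_num)]
    simp
  rw [h2, ← h1]
  have h3 : ENNReal.ofReal ((C : ℝ) ^ 2) = (C : ℝ≥0∞) ^ ((2 : ℝ≥0) : ℝ) := by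
    rw [ENNReal.ofReal_pow (by positivity)]; simp
  rw [h3]
  exact ENNReal.rpow_le_rpow h (by norm_num)

theorem abs_integral_le_one_add {α : Type*} [MeasurableSpace α] {μ : Measure α}
    [IsProbabilityMeasure μ] {f : α → ℝ} (hf : MemLp f 2 μ) :
    |∫ z, f z ∂μ| ≤ 1 + ∫ z, f z ^ 2 ∂μ := by
  have h1 : ∫ z, |f z| ∂μ ≤ ∫ z, (1 + f z ^ 2) ∂μ :=
    integral_mono (hf.integrable (by norm_num)).abs ((integrable_const 1).add hf.integrable_sq)
      fun z => by
        change |f z| ≤ 1 + f z ^ 2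
        nlinarith [sq_abs (f z), sq_nonneg (|f z| - 1)]
  rw [integral_add (integrable_const 1) hf.integrable_sq] at h1
  simpa using (abs_integral_le_integral_abs).trans h1

/-- The constant is the minimum of the form on the compact unit sphere; homogeneity does the rest.
-/
theorem exists_coercive_of_posDef {n : Type*} [Fintype n] [DecidableEq n] {A : Matrix n n ℝ}
    (hA : A.PosDef) : ∃ c : ℝ, 0 < c ∧ ∀ u : n → ℝ, c * (u ⬝ᵥ u) ≤ u ⬝ᵥ (A *ᵥ u) := by
  rcases isEmpty_or_nonempty n with hn | hn
  · exact ⟨1, one_pos, fun u => by simp [dotProduct]⟩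
  have hcont : Continuous fun u : EuclideanSpace ℝ n => u.ofLp ⬝ᵥ (A *ᵥ u.ofLp) := by fun_prop
  obtain ⟨u₀, hu₀, hmin⟩ := (isCompact_sphere (0 : EuclideanSpace ℝ n) 1).exists_isMinOn
    (NormedSpace.sphere_nonempty.2 zero_le_one) hcont.continuousOn
  have hu₀' : u₀.ofLp ≠ 0 := by
    intro h
    have : u₀ = 0 := by ext i; simp [h]
    simp [this] at hu₀
  refine ⟨u₀.ofLp ⬝ᵥ (A *ᵥ u₀.ofLp), by simpa using hA.dotProduct_mulVec_pos hu₀', fun u => ?_⟩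
  let x : EuclideanSpace ℝ n := WithLp.toLp 2 u
  have hx2 : u ⬝ᵥ u = ‖x‖ ^ 2 := by
    rw [EuclideanSpace.real_norm_sq_eq]
    simp [dotProduct, x, sq]
  rcases (norm_nonneg x).eq_or_lt with h0 | h0
  · have : x = 0 := norm_eq_zero.1 h0.symm
    have hu : u = 0 := by simpa [x] using this
    simp [hu]
  have h1 := hmin (a := ‖x‖⁻¹ • x) (by simp [norm_smul, h0.ne'])
  simp only [Set.mem_ofPred_eq, WithLp.ofLp_smul, Matrix.mulVec_smul, smul_dotProduct,
    dotProduct_smul, smul_eq_mul] at h1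
  rw [hx2]
  have hxu : x.ofLp = u := rfl
  rw [hxu] at h1
  calc _ ≤ ‖x‖⁻¹ * (‖x‖⁻¹ * u ⬝ᵥ A *ᵥ u) * ‖x‖ ^ 2 := by gcongr
    _ = _ := by field_simp

/-! ### Laws of large numbers over the workers. -/

namespace Model

variable {p : ℕ} {Ω : Type*} {S : Model p Ω}

theorem K_pos {N : ℕ} (hN : 0 < N) : 0 < S.K N :=
  lt_of_le_of_lt (Nat.zero_le _) (S.worker N ⟨0, hN⟩).isLt

theorem avgSize_pos {N : ℕ} (hN : 0 < N) : 0 < S.avgSize N :=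
  div_pos (by exact_mod_cast hN) (by exact_mod_cast K_pos hN)

theorem BalancedWorkers.size_pos (h : S.BalancedWorkers) {N : ℕ} (hN : 0 < N) (k : Fin (S.K N)) :
    0 < S.size N k := by
  obtain ⟨c₁, c₂, h1, -, h⟩ := h
  have := (mul_pos h1 (avgSize_pos (S := S) hN)).trans_le (h N k).1
  exact_mod_cast this

/-- Since `n = N / K`, the quantity `K / √N` is the reciprocal of `n / √N`. -/
theorem tendsto_K_div_sqrt (hn : Tendsto (fun N : ℕ => S.avgSize N / Real.sqrt N) atTop atTop) :
    Tendsto (fun N : ℕ => (S.K N : ℝ) / Real.sqrt N) atTop (𝓝 0) := by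
  refine (tendsto_inv_atTop_zero.comp hn).congr' ?_
  filter_upwards [eventually_gt_atTop 0] with N hN
  have hN' : (0 : ℝ) < N := by exact_mod_cast hN
  have hs := Real.sqrt_pos.2 hN'
  have hs2 := Real.mul_self_sqrt hN'.le
  have hK : (0 : ℝ) < S.K N := by exact_mod_cast K_pos (S := S) hN
  simp only [Function.comp, avgSize]
  field_simp
  nlinarith

/-- Balance bounds the sum by `K / (c₁ * n) = K ^ 2 / (c₁ * N)`. This sum is what a union of
Chebyshev bounds over all workers produces. -/
theorem BalancedWorkers.tendsto_sum_inv_size (h : S.BalancedWorkers)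
    (hn : Tendsto (fun N : ℕ => S.avgSize N / Real.sqrt N) atTop atTop) :
    Tendsto (fun N : ℕ => ∑ k : Fin (S.K N), (S.size N k : ℝ)⁻¹) atTop (𝓝 0) := by
  obtain ⟨c₁, c₂, h1, -, hb⟩ := id h
  have hlim : Tendsto (fun N : ℕ => c₁⁻¹ * ((S.K N : ℝ) / Real.sqrt N) ^ 2) atTop (𝓝 0) := by
    simpa using ((tendsto_K_div_sqrt hn).pow 2).const_mul c₁⁻¹
  refine tendsto_of_tendsto_of_tendsto_of_le_of_le' tendsto_const_nhds hlim
    (Eventually.of_forall fun N => by positivity) ?_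
  filter_upwards [eventually_gt_atTop 0] with N hN
  have hN' : (0 : ℝ) < N := by exact_mod_cast hN
  have hK : (0 : ℝ) < S.K N := by exact_mod_cast K_pos (S := S) hN
  have hs2 := Real.sq_sqrt hN'.le
  calc _ ≤ ∑ _k : Fin (S.K N), (c₁ * S.avgSize N)⁻¹ := Finset.sum_le_sum fun k _ =>
        inv_anti₀ (mul_pos h1 (avgSize_pos hN)) (hb N k).1
    _ = _ := by
      rw [Finset.sum_const, Finset.card_univ, Fintype.card_fin, nsmul_eq_mul, avgSize, div_pow, hs2]
      field_simp

theorem abs_localMean_sub_le {N : ℕ} {ω : Ω} {k : Fin (S.K N)}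
    {f g : EuclideanSpace ℝ (Fin p) × ℝ → ℝ} :
    |S.localMean f N ω k - S.localMean g N ω k| ≤ S.localMean (fun z => |f z - g z|) N ω k := by
  simp only [localMean]
  rw [← mul_sub, ← Finset.sum_sub_distrib, abs_mul, abs_of_nonneg (by positivity : _ ≤ _)]
  exact mul_le_mul_of_nonneg_left (Finset.abs_sum_le_sum_abs _ _) (by positivity)

variable [MeasurableSpace Ω] {P : Measure Ω} [IsProbabilityMeasure P]
  {f : EuclideanSpace ℝ (Fin p) × ℝ → ℝ}

/-- Uniform law of large numbers over the workers under uniformly bounded second moments. -/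
theorem Sampling.withHighProb_localMean_of_sq_le (hs : S.Sampling P) (hbal : S.BalancedWorkers)
    (hn : Tendsto (fun N : ℕ => S.avgSize N / Real.sqrt N) atTop atTop) {v : ℝ}
    (hf : ∀ N, 0 < N → ∀ k : Fin (S.K N), MemLp f 2 (S.law k) ∧ ∫ z, f z ^ 2 ∂(S.law k) ≤ v)
    {ε : ℝ} (hε : 0 < ε) :
    WithHighProb P fun N ω => ∀ k, |S.localMean f N ω k - ∫ z, f z ∂(S.law k)| ≤ ε := by
  have hlim := (hbal.tendsto_sum_inv_size hn).const_mul (v / ε ^ 2)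
  rw [mul_zero] at hlim
  refine withHighProb_of_le hlim ?_
  filter_upwards [eventually_gt_atTop 0] with N hN
  have hv : 0 ≤ v := (integral_nonneg fun z => sq_nonneg (f z)).trans (hf N hN ⟨0, K_pos hN⟩).2
  calc _ ≤ P (⋃ k : Fin (S.K N),
        {ω | ε ≤ |S.localMean f N ω k - ∫ z, f z ∂(S.law k)|}) := by
        refine measure_mono fun ω hω => ?_
        obtain ⟨k, hk⟩ := not_forall.1 hω
        exact Set.mem_iUnion.2 ⟨k, (not_le.1 hk).le⟩
    _ ≤ ∑ k : Fin (S.K N), P {ω | ε ≤ |S.localMean f N ω k - ∫ z, f z ∂(S.law k)|} :=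
        measure_iUnion_fintype_le _ _
    _ ≤ ∑ k : Fin (S.K N), ENNReal.ofReal (v / ε ^ 2 * (S.size N k : ℝ)⁻¹) :=
        Finset.sum_le_sum fun k _ =>
          hs.measure_localMean_ge_le (hbal.size_pos hN k) hε (hf N hN k).1 (hf N hN k).2
    _ = _ := by
      rw [← ENNReal.ofReal_sum_of_nonneg fun k _ => by positivity, Finset.mul_sum]

/-- Weak law of large numbers on a fixed worker, under a first moment only. -/
theorem Sampling.withHighProb_localMean_of_integrable (hs : S.Sampling P)
    (hbal : S.BalancedWorkers)
    (hn : Tendsto (fun N : ℕ => S.avgSize N / Real.sqrt N) atTop atTop)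
    (hf : ∀ N, 0 < N → ∀ k : Fin (S.K N), Integrable f (S.law k)) (k : ℕ) {ε : ℝ} (hε : 0 < ε) :
    WithHighProb P fun N ω => ∀ h : k < S.K N,
      |S.localMean f N ω ⟨k, h⟩ - ∫ z, f z ∂(S.law k)| ≤ ε := by
  -- An index that never occurs for positive `N` makes the claim vacuous; otherwise one occurrence
  -- supplies integrability and the probability measure.
  by_cases hocc : ∃ N, 0 < N ∧ k < S.K N
  swap
  · refine withHighProb_of_eventually_ae ?_
    filter_upwards [eventually_gt_atTop 0] with N hN
    exact ae_of_all _ fun ω h => absurd ⟨N, hN, h⟩ hocc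
  obtain ⟨N₀, hN₀, hk₀⟩ := hocc
  have hfk : Integrable f (S.law k) := hf N₀ hN₀ ⟨k, hk₀⟩
  obtain ⟨i₀, hi₀⟩ := exists_worker_eq (hbal.size_pos hN₀ ⟨k, hk₀⟩)
  have hprob : IsProbabilityMeasure (S.law k) := by
    have := hs.isProbabilityMeasure_law i₀
    rwa [hi₀] at this
  refine ENNReal.tendsto_nhds_zero.2 fun τ hτ => ?_
  obtain ⟨η, hη0, hητ⟩ := ENNReal.lt_iff_exists_nnreal_btwn.1 hτ
  have hη : (0 : ℝ) < η := by exact_mod_cast hη0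
  -- `f` is replaced by a simple function within `κ` in `L¹`, which has a second moment. The first
  -- entry of the minimum keeps the change of mean below `ε / 3`; the second lets Markov's
  -- inequality bound the averaged error with probability `η / 2`.
  set κ : ℝ := min (ε / 3) (ε / 3 * (η / 2)) with hκ
  have hκ0 : 0 < κ := by positivity
  obtain ⟨g, hg, hgLp⟩ := (memLp_one_iff_integrable.2 hfk).exists_simpleFunc_eLpNorm_sub_lt
    (by simp) (ENNReal.ofReal_pos.2 hκ0).ne'
  have hg2 : MemLp g 2 (S.law k) := SimpleFunc.memLp_of_isFiniteMeasure g 2 _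
  have hgint : Integrable g (S.law k) := memLp_one_iff_integrable.1 hgLp
  have hdint : Integrable (fun z => |f z - g z|) (S.law k) := (hfk.sub hgint).abs
  have hd : ∫ z, |f z - g z| ∂(S.law k) ≤ κ := by
    have h1 := integral_norm_eq_lintegral_enorm (hfk.sub hgint).1
    rw [← eLpNorm_one_eq_lintegral_enorm] at h1
    refine (le_of_eq h1).trans (ENNReal.toReal_le_of_le_ofReal hκ0.le hg.le)
  have hmean : |∫ z, f z ∂(S.law k) - ∫ z, g z ∂(S.law k)| ≤ κ := by
    rw [← integral_sub hfk hgint]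
    exact abs_integral_le_integral_abs.trans hd
  set v := ∫ z, g z ^ 2 ∂(S.law k) with hv
  have hv0 : 0 ≤ v := integral_nonneg fun z => sq_nonneg _
  have hε3 : 0 < ε / 3 := by positivity
  have hlim := (hbal.tendsto_sum_inv_size hn).const_mul (v / (ε / 3) ^ 2)
  rw [mul_zero] at hlim
  filter_upwards [eventually_gt_atTop 0, hlim.eventually_le_const (half_pos hη)] with N hN hsmall
  by_cases hk : k < S.K N
  swap
  · have : {ω | ¬ ∀ h : k < S.K N, |S.localMean f N ω ⟨k, h⟩ - ∫ z, f z ∂(S.law k)| ≤ ε} = ∅ :=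
      Set.eq_empty_of_forall_notMem fun ω hω => hω fun h => absurd h hk
    rw [this, measure_empty]
    exact zero_le
  set k' : Fin (S.K N) := ⟨k, hk⟩ with hk'
  have hsize := hbal.size_pos hN k'
  have hcheb : P {ω | ε / 3 ≤ |S.localMean g N ω k' - ∫ z, g z ∂(S.law k)|} ≤
      ENNReal.ofReal (η / 2) := by
    refine (hs.measure_localMean_ge_le hsize hε3 hg2 le_rfl).trans (ENNReal.ofReal_le_ofReal ?_)
    refine le_trans (mul_le_mul_of_nonneg_left ?_ (by positivity)) hsmall
    exact Finset.single_le_sum (f := fun k : Fin (S.K N) => (S.size N k : ℝ)⁻¹)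
      (fun _ _ => by positivity) (Finset.mem_univ k')
  have hmarkov : P {ω | ε / 3 ≤ S.localMean (fun z => |f z - g z|) N ω k'} ≤
      ENNReal.ofReal (η / 2) := by
    have hint : Integrable (fun ω => S.localMean (fun z => |f z - g z|) N ω k') P :=
      hs.integrable_localMean hdint
    have h1 := mul_meas_ge_le_integral_of_nonneg
      (ae_of_all P fun ω => show 0 ≤ S.localMean (fun z => |f z - g z|) N ω k' by
        unfold localMean; positivity) hint (ε / 3)
    rw [hs.integral_localMean hsize hdint] at h1
    rw [← ofReal_measureReal]
    refine ENNReal.ofReal_le_ofReal (le_of_mul_le_mul_left ?_ hε3)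
    exact h1.trans (hd.trans (min_le_right _ _))
  calc _ ≤ P ({ω | ε / 3 ≤ |S.localMean g N ω k' - ∫ z, g z ∂(S.law k)|} ∪
        {ω | ε / 3 ≤ S.localMean (fun z => |f z - g z|) N ω k'}) := by
        refine measure_mono fun ω hω => ?_
        by_contra hcon
        simp only [Set.mem_union, Set.mem_ofPred_eq, not_or, not_le] at hcon
        refine hω fun h => ?_
        have h1 := abs_localMean_sub_le (S := S) (f := f) (g := g) (ω := ω) (k := k')
        have h2 : κ ≤ ε / 3 := min_le_left _ _
        rw [abs_le] at *
        rw [abs_lt] at hcon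
        constructor <;> linarith [hcon.1.1, hcon.1.2, hcon.2]
    _ ≤ ENNReal.ofReal (η / 2) + ENNReal.ofReal (η / 2) :=
        (measure_union_le _ _).trans (add_le_add hcheb hmarkov)
    _ = η := by
      rw [← ENNReal.ofReal_add (by positivity) (by positivity), add_halves]
      exact ENNReal.ofReal_coe_nnreal
    _ ≤ τ := hητ.le

/-- Law of large numbers uniformly over the workers. -/
theorem Sampling.withHighProb_localMean (hs : S.Sampling P) (hbal : S.BalancedWorkers)
    (hn : Tendsto (fun N : ℕ => S.avgSize N / Real.sqrt N) atTop atTop)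
    (hf : ∀ N, 0 < N → ∀ k : Fin (S.K N), Integrable f (S.law k))
    (hK : (∃ K₀ : ℕ, ∀ N, S.K N ≤ K₀) ∨ ∃ C : ℝ≥0, ∀ N, 0 < N → ∀ k : Fin (S.K N),
      eLpNorm f 2 (S.law k) ≤ C) {ε : ℝ} (hε : 0 < ε) :
    WithHighProb P fun N ω => ∀ k, |S.localMean f N ω k - ∫ z, f z ∂(S.law k)| ≤ ε := by
  rcases hK with ⟨K₀, hK₀⟩ | ⟨C, hC⟩
  · have h := withHighProb_forall (P := P) fun j : Fin K₀ =>
      hs.withHighProb_localMean_of_integrable hbal hn hf j hε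
    exact h.mono (Eventually.of_forall fun N ω hω k =>
      hω ⟨k, k.isLt.trans_le (hK₀ N)⟩ k.isLt)
  · exact hs.withHighProb_localMean_of_sq_le hbal hn (fun N hN k =>
      ⟨⟨(hf N hN k).1, (hC N hN k).trans_lt ENNReal.coe_lt_top⟩,
        integral_sq_le_of_eLpNorm_le (hf N hN k).1 (hC N hN k)⟩) hε

/-! ### Moment bounds uniform over the workers, and orders of the scores. -/

variable {p : ℕ} {Ω : Type*} {S : Model p Ω}

/-- The quadratic form at `x` is the second moment of `∑ a, x a * g a`. Together with nonsingularity
this yields positive definiteness. -/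
theorem posSemidef_info {k : ℕ}
    (h : ∀ a, MemLp (fun z => pd1 (fun θ => S.loss θ z) S.θ₀ a) 2 (S.law k)) :
    (S.info k).PosSemidef := by
  set g : Fin p → EuclideanSpace ℝ (Fin p) × ℝ → ℝ :=
    fun a z => pd1 (fun θ => S.loss θ z) S.θ₀ a with hg
  have hint (a b) : Integrable (fun z => g a z * g b z) (S.law k) := (h a).integrable_mul (h b)
  refine Matrix.PosSemidef.of_dotProduct_mulVec_nonneg ?_ fun x => ?_
  · ext a b
    simp [info, mul_comm]
  · have h1 : star x ⬝ᵥ (S.info k *ᵥ x) = ∫ z, (∑ a, x a * g a z) ^ 2 ∂(S.law k) := by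
      have h2 (z) : (∑ a, x a * g a z) ^ 2 = ∑ a, ∑ b, x a * x b * (g a z * g b z) := by
        rw [sq, Finset.sum_mul_sum]
        exact Finset.sum_congr rfl fun a _ => Finset.sum_congr rfl fun b _ => by ring
      simp only [h2]
      rw [integral_finsetSum _ fun a _ => integrable_finsetSum _ fun b _ => (hint a b).const_mul _]
      simp only [star_trivial, dotProduct, Matrix.mulVec, Finset.mul_sum]
      refine Finset.sum_congr rfl fun a _ => ?_
      rw [integral_finsetSum _ fun b _ => (hint a b).const_mul _]
      refine Finset.sum_congr rfl fun b _ => ?_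
      rw [integral_const_mul]
      simp only [info, Matrix.of_apply, hg]
      ring
    rw [h1]
    exact integral_nonneg fun z => sq_nonneg _

theorem exists_forall_le_of_bounded {K₀ : ℕ} (hK : ∀ N, S.K N ≤ K₀) (v : ℕ → ℝ) :
    ∃ C, 0 ≤ C ∧ ∀ N (k : Fin (S.K N)), v k ≤ C :=
  ⟨∑ j ∈ Finset.range K₀, |v j|, Finset.sum_nonneg fun _ _ => abs_nonneg _, fun N k =>
    (le_abs_self _).trans (Finset.single_le_sum (f := fun j => |v j|) (fun _ _ => abs_nonneg _)
      (Finset.mem_range.2 (k.isLt.trans_le (hK N))))⟩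

/-- Bounds on the first two moments that hold uniformly over the workers. -/
structure MomentBounds (S : Model p Ω)
    (Mb : Fin p → Fin p → Fin p → EuclideanSpace ℝ (Fin p) × ℝ → ℝ) (c v : ℝ) : Prop where
  pos : 0 < c
  nonneg : 0 ≤ v
  info_ge : ∀ N, 0 < N → ∀ k : Fin (S.K N), ∀ u : Fin p → ℝ, c * (u ⬝ᵥ u) ≤ u ⬝ᵥ (S.info k *ᵥ u)
  grad_le : ∀ N, 0 < N → ∀ k : Fin (S.K N), ∀ a,
    ∫ z, pd1 (fun θ => S.loss θ z) S.θ₀ a ^ 2 ∂(S.law k) ≤ v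
  hess_le : ∀ N, 0 < N → ∀ k : Fin (S.K N), ∀ a b,
    |∫ z, pd2 (fun θ => S.loss θ z) S.θ₀ a b ∂(S.law k)| ≤ v
  third_le : ∀ N, 0 < N → ∀ k : Fin (S.K N), ∀ i j l, ∫ z, Mb i j l z ∂(S.law k) ≤ v

theorem exists_momentBounds_of_bounded {K₀ : ℕ} (hK : ∀ N, S.K N ≤ K₀) (hconv : S.LocalConvexity)
    (Mb : Fin p → Fin p → Fin p → EuclideanSpace ℝ (Fin p) × ℝ → ℝ) :
    ∃ c v, S.MomentBounds Mb c v := by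
  have hex (k : ℕ) : ∃ c : ℝ, 0 < c ∧ ((∃ N, k < S.K N) →
      ∀ u : Fin p → ℝ, c * (u ⬝ᵥ u) ≤ u ⬝ᵥ (S.info k *ᵥ u)) := by
    by_cases h : ∃ N, k < S.K N
    · obtain ⟨N, hN⟩ := h
      obtain ⟨h1, -, h3⟩ := hconv N ⟨k, hN⟩
      obtain ⟨c, hc, hcu⟩ := exists_coercive_of_posDef
        ((posSemidef_info h1).posDef_iff_det_ne_zero.2 h3.ne_zero)
      exact ⟨c, hc, fun _ => hcu⟩
    · exact ⟨1, one_pos, fun h' => absurd h' h⟩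
  choose c hc hcu using hex
  obtain ⟨C, hC0, hC⟩ := exists_forall_le_of_bounded hK fun k => (c k)⁻¹
  obtain ⟨v, hv0, hv⟩ := exists_forall_le_of_bounded hK fun k =>
    (∑ a, |∫ z, pd1 (fun θ => S.loss θ z) S.θ₀ a ^ 2 ∂(S.law k)|) +
    (∑ a, ∑ b, |∫ z, pd2 (fun θ => S.loss θ z) S.θ₀ a b ∂(S.law k)|) +
    ∑ i, ∑ j, ∑ l, |∫ z, Mb i j l z ∂(S.law k)|
  have hsingle {ι : Type} [Fintype ι] (g : ι → ℝ) (hg : ∀ i, 0 ≤ g i) (i : ι) : g i ≤ ∑ j, g j :=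
    Finset.single_le_sum (fun j _ => hg j) (Finset.mem_univ i)
  -- `C` dominates every `(c k)⁻¹` that occurs, so `(C + 1)⁻¹` is a common ellipticity constant; the
  -- added `1` keeps it positive even for `C = 0`.
  refine ⟨(C + 1)⁻¹, v, by positivity, hv0, fun N hN k u => ?_, fun N hN k a => ?_,
    fun N hN k a b => ?_, fun N hN k i j l => ?_⟩
  · refine le_trans ?_ (hcu k ⟨N, k.isLt⟩ u)
    refine mul_le_mul_of_nonneg_right ?_ (by
      rw [dotProduct]; exact Finset.sum_nonneg fun i _ => mul_self_nonneg _)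
    rw [inv_le_comm₀ (by positivity) (hc k)]
    linarith [hC N k]
  all_goals refine le_trans ?_ (hv N k)
  · have h1 := hsingle (fun a => |∫ z, pd1 (fun θ => S.loss θ z) S.θ₀ a ^ 2 ∂(S.law k)|)
      (fun _ => abs_nonneg _) a
    refine le_trans ((le_abs_self _).trans h1) ?_
    rw [add_assoc]
    exact le_add_of_nonneg_right (by positivity)
  · have h1 := hsingle (fun b => |∫ z, pd2 (fun θ => S.loss θ z) S.θ₀ a b ∂(S.law k)|)
      (fun _ => abs_nonneg _) b
    have h2 := hsingle (fun a => ∑ b, |∫ z, pd2 (fun θ => S.loss θ z) S.θ₀ a b ∂(S.law k)|)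
      (fun _ => by positivity) a
    refine le_trans (h1.trans h2) ?_
    refine le_trans (le_add_of_nonneg_left ?_) (le_add_of_nonneg_right ?_) <;> positivity
  · have h1 := hsingle (fun l => |∫ z, Mb i j l z ∂(S.law k)|) (fun _ => abs_nonneg _) l
    have h2 := hsingle (fun j => ∑ l, |∫ z, Mb i j l z ∂(S.law k)|) (fun _ => by positivity) j
    have h3 := hsingle (fun i => ∑ j, ∑ l, |∫ z, Mb i j l z ∂(S.law k)|)
      (fun _ => by positivity) i
    refine le_trans (((le_abs_self _).trans h1).trans (h2.trans h3)) ?_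
    exact le_add_of_nonneg_left (by positivity)

variable [MeasurableSpace Ω] {P : Measure Ω}

theorem Sampling.ae_forall_of_ae (hs : S.Sampling P) {N : ℕ}
    {A : EuclideanSpace ℝ (Fin p) × ℝ → Prop}
    (h : ∀ k : Fin (S.K N), ∀ᵐ z ∂(S.law k), A z) : ∀ᵐ ω ∂P, ∀ i, A (S.Z N i ω) := by
  refine ae_all_iff.2 fun i => ?_
  have h1 := h (S.worker N i)
  rw [← (hs N).2.2 i] at h1
  exact ae_of_ae_map ((hs N).1 i).aemeasurable h1

variable [IsProbabilityMeasure P]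

theorem Sampling.isProbabilityMeasure_law_of_pos (hs : S.Sampling P) (hbal : S.BalancedWorkers)
    {N : ℕ} (hN : 0 < N) (k : Fin (S.K N)) : IsProbabilityMeasure (S.law k) := by
  obtain ⟨i, hi⟩ := exists_worker_eq (hbal.size_pos hN k)
  exact hi ▸ hs.isProbabilityMeasure_law i

variable {Mb : Fin p → Fin p → Fin p → EuclideanSpace ℝ (Fin p) × ℝ → ℝ}

theorem Sampling.exists_momentBounds (hs : S.Sampling P) (hbal : S.BalancedWorkers)
    (hconv : S.LocalConvexity) (hsmooth : S.SmoothnessWith Mb)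
    (hK : (∃ K₀ : ℕ, ∀ N, S.K N ≤ K₀) ∨ S.UniformMoments Mb) : ∃ c v, S.MomentBounds Mb c v := by
  rcases hK with ⟨K₀, hK₀⟩ | ⟨c, η, C, hc, hη, h⟩
  · exact exists_momentBounds_of_bounded hK₀ hconv Mb
  have habs {N : ℕ} (hN : 0 < N) (k : Fin (S.K N)) {f : EuclideanSpace ℝ (Fin p) × ℝ → ℝ}
      (hf : AEStronglyMeasurable f (S.law k)) (h2 : eLpNorm f 2 (S.law k) ≤ C) :
      |∫ z, f z ∂(S.law k)| ≤ 1 + (C : ℝ) ^ 2 := by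
    have := hs.isProbabilityMeasure_law_of_pos hbal hN k
    have h3 := abs_integral_le_one_add ⟨hf, h2.trans_lt ENNReal.coe_lt_top⟩
    linarith [integral_sq_le_of_eLpNorm_le hf h2]
  obtain ⟨δ, -, hMb⟩ := hsmooth
  refine ⟨c, 1 + (C : ℝ) ^ 2, hc, by positivity, fun N _ k => (h N k).1, fun N hN k a => ?_,
    fun N hN k a b => habs hN k ((hconv N k).2.1 a b).1.1 ((h N k).2.2.1 a b), fun N hN k i j l =>
      (le_abs_self _).trans (habs hN k ((hMb N k).2 i j l).1 ((h N k).2.2.2 i j l))⟩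
  have := hs.isProbabilityMeasure_law_of_pos hbal hN k
  have hmeas := ((hconv N k).1 a).1
  -- On a probability space the `L²` norm is at most the `L^(2 + η)` norm.
  have h2 : (2 : ℝ≥0∞) ≤ ENNReal.ofReal (2 + η) := by
    rw [← ENNReal.ofReal_ofNat 2]; exact ENNReal.ofReal_le_ofReal (by linarith)
  have := integral_sq_le_of_eLpNorm_le hmeas
    ((eLpNorm_le_eLpNorm_of_exponent_le h2 hmeas).trans ((h N k).2.1 a))
  linarith

/-- The weighted squares of the local averages of a centred function are `o_p(N^{-1/2})`. -/
theorem Sampling.withHighProb_weighted_sq_localMean_le (hs : S.Sampling P)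
    (hbal : S.BalancedWorkers)
    (hn : Tendsto (fun N : ℕ => S.avgSize N / Real.sqrt N) atTop atTop)
    {f : EuclideanSpace ℝ (Fin p) × ℝ → ℝ} {v : ℝ}
    (hf : ∀ N, 0 < N → ∀ k : Fin (S.K N), MemLp f 2 (S.law k) ∧ ∫ z, f z ∂(S.law k) = 0 ∧
      ∫ z, f z ^ 2 ∂(S.law k) ≤ v) {ε : ℝ} (hε : 0 < ε) :
    WithHighProb P fun N ω =>
      Real.sqrt N * ∑ k, S.weight N k * S.localMean f N ω k ^ 2 ≤ ε := by
  have hlim := (tendsto_K_div_sqrt hn).const_mul (ε⁻¹ * v)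
  rw [mul_zero] at hlim
  refine withHighProb_of_le hlim ?_
  filter_upwards [eventually_gt_atTop 0] with N hN
  have hN' : (0 : ℝ) < N := by exact_mod_cast hN
  have hsq := Real.mul_self_sqrt hN'.le
  have hsN := Real.sqrt_pos.2 hN'
  have hint (k : Fin (S.K N)) : Integrable (fun ω => S.localMean f N ω k ^ 2) P :=
    (hs.memLp_localMean (hf N hN k).1).integrable_sq
  have hk (k : Fin (S.K N)) : ∫ ω, S.localMean f N ω k ^ 2 ∂P ≤ v / S.size N k := by
    have := hs.isProbabilityMeasure_law_of_pos hbal hN k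
    have hmem := hs.memLp_localMean (hf N hN k).1
    have h0 : ∫ ω, S.localMean f N ω k ∂P = 0 := by
      rw [hs.integral_localMean (hbal.size_pos hN k) ((hf N hN k).1.integrable (by norm_num)),
        (hf N hN k).2.1]
    rw [← variance_of_integral_eq_zero hmem.1.aemeasurable h0]
    exact hs.variance_localMean_le (hbal.size_pos hN k) (hf N hN k).1 (hf N hN k).2.2
  have hX : Integrable (fun ω => Real.sqrt N * ∑ k, S.weight N k * S.localMean f N ω k ^ 2) P :=
    (integrable_finsetSum _ fun k _ => (hint k).const_mul _).const_mul _
  -- Each worker contributes `α_k * v / n_k = v / N`, whatever its size, so the `K` terms times `√N`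
  -- give `v * K / √N`. Markov's inequality finishes the argument.
  have hEX : ∫ ω, Real.sqrt N * ∑ k, S.weight N k * S.localMean f N ω k ^ 2 ∂P ≤
      v * ((S.K N : ℝ) / Real.sqrt N) := by
    rw [integral_const_mul, integral_finsetSum _ fun k _ => (hint k).const_mul _]
    simp only [integral_const_mul]
    calc _ ≤ Real.sqrt N * ∑ _k : Fin (S.K N), v / N := by
          gcongr with k _
          have hk0 : (0 : ℝ) < S.size N k := by exact_mod_cast hbal.size_pos hN k
          calc _ ≤ S.weight N k * (v / S.size N k) :=
                mul_le_mul_of_nonneg_left (hk k) (S.weight_nonneg k)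
            _ = _ := by rw [weight]; field_simp
      _ = _ := by
        rw [Finset.sum_const, Finset.card_univ, Fintype.card_fin, nsmul_eq_mul]
        field_simp
        rw [sq, hsq]
        ring
  have h1 := mul_meas_ge_le_integral_of_nonneg
    (ae_of_all P fun ω => show 0 ≤ Real.sqrt N * ∑ k, S.weight N k * S.localMean f N ω k ^ 2 from
      mul_nonneg hsN.le (Finset.sum_nonneg fun k _ =>
        mul_nonneg (S.weight_nonneg k) (sq_nonneg _))) hX ε
  refine (measure_mono (t := {ω | ε ≤
    Real.sqrt N * ∑ k, S.weight N k * S.localMean f N ω k ^ 2}) fun ω hω =>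
      (not_le.1 hω).le).trans ?_
  rw [← ofReal_measureReal]
  refine ENNReal.ofReal_le_ofReal (le_of_mul_le_mul_left ?_ hε)
  refine (h1.trans hEX).trans_eq ?_
  field_simp

/-- The normalized total sum of a centred function is bounded in probability. -/
theorem Sampling.boundedInProb_globalMean (hs : S.Sampling P)
    {f : EuclideanSpace ℝ (Fin p) × ℝ → ℝ} {v : ℝ}
    (hf : ∀ N, 0 < N → ∀ k : Fin (S.K N), MemLp f 2 (S.law k) ∧ ∫ z, f z ∂(S.law k) = 0 ∧
      ∫ z, f z ^ 2 ∂(S.law k) ≤ v) :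
    BoundedInProb P fun N ω => Real.sqrt N * |(N : ℝ)⁻¹ * ∑ i, f (S.Z N i ω)| := by
  have hv0 : 0 ≤ v := (integral_nonneg fun z => sq_nonneg (f z)).trans
    (hf 1 one_pos ⟨0, K_pos one_pos⟩).2.2
  intro ε hε
  have hlim : Tendsto (fun n : ℕ => ENNReal.ofReal (v / ((n : ℝ) + 1) ^ 2)) atTop (𝓝 0) := by
    have h1 : Tendsto (fun n : ℕ => v / ((n : ℝ) + 1) ^ 2) atTop (𝓝 0) := by
      have := (tendsto_one_div_add_atTop_nhds_zero_nat (𝕜 := ℝ)).pow 2 |>.const_mul v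
      simpa [div_eq_mul_inv] using this
    simpa using ENNReal.tendsto_ofReal h1
  -- The sum has variance at most `N * v`, so Chebyshev at radius `n + 1` leaves probability at most
  -- `v / (n + 1) ^ 2`, uniformly in `N`.
  obtain ⟨n, hn⟩ := (hlim.eventually (gt_mem_nhds hε)).exists
  refine ⟨n + 1, ?_⟩
  filter_upwards [eventually_gt_atTop 0] with N hN
  have hN' : (0 : ℝ) < N := by exact_mod_cast hN
  have hsq := Real.mul_self_sqrt hN'.le
  have hsN := Real.sqrt_pos.2 hN'
  have hmem : MemLp (fun ω => ∑ i, f (S.Z N i ω)) 2 P :=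
    hs.memLp_sum fun i _ => (hf N hN (S.worker N i)).1
  have hmean : ∫ ω, ∑ i, f (S.Z N i ω) ∂P = 0 := by
    have hint (i : Fin N) : Integrable f (S.law (S.worker N i)) := by
      have := hs.isProbabilityMeasure_law i
      exact (hf N hN _).1.integrable (by norm_num)
    rw [integral_finsetSum _ fun i _ => hs.integrable_comp i (hint i)]
    refine Finset.sum_eq_zero fun i _ => ?_
    rw [hs.integral_comp i (hint i).1, (hf N hN _).2.1]
  have hvar := hs.variance_sum_le (s := Finset.univ) (v := v)
    (fun i _ => (hf N hN (S.worker N i)).1) (fun i _ => (hf N hN (S.worker N i)).2.2)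
  have hR : (0 : ℝ) < Real.sqrt N * (n + 1) := by positivity
  have h1 := meas_ge_le_variance_div_sq hmem hR
  rw [hmean] at h1
  refine (measure_mono fun ω hω => ?_).trans ((h1.trans (ENNReal.ofReal_le_ofReal ?_)).trans hn.le)
  · have h2 : (n : ℝ) + 1 < Real.sqrt N * |(N : ℝ)⁻¹ * ∑ i, f (S.Z N i ω)| := not_le.1 hω
    rw [abs_mul, abs_of_pos (inv_pos.2 hN')] at h2
    change Real.sqrt N * (n + 1) ≤ |∑ i, f (S.Z N i ω) - 0|
    rw [sub_zero]
    calc Real.sqrt N * (n + 1) ≤ Real.sqrt N * (Real.sqrt N *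
          ((N : ℝ)⁻¹ * |∑ i, f (S.Z N i ω)|)) := by gcongr
      _ = (Real.sqrt N * Real.sqrt N) * (N : ℝ)⁻¹ * |∑ i, f (S.Z N i ω)| := by ring
      _ = _ := by rw [hsq, mul_inv_cancel₀ hN'.ne', one_mul]
  · rw [Finset.card_univ, Fintype.card_fin] at hvar
    calc _ ≤ N * v / (Real.sqrt N * (n + 1)) ^ 2 := by gcongr
      _ = _ := by
        rw [mul_pow, sq (Real.sqrt N), hsq]
        field_simp

end Model

theorem norm_restrict_le {p : ℕ} (T : Finset (Fin p)) (v : EuclideanSpace ℝ (Fin p)) :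
    ‖restrict T v‖ ≤ ‖v‖ := by
  rw [EuclideanSpace.norm_eq, EuclideanSpace.norm_eq]
  refine Real.sqrt_le_sqrt ?_
  simp only [restrict]
  rw [Finset.sum_coe_sort T fun j => ‖v j‖ ^ 2]
  exact Finset.sum_le_sum_of_subset_of_nonneg (Finset.subset_univ T) fun _ _ _ => sq_nonneg _

theorem norm_restrict_eq {p : ℕ} {T : Finset (Fin p)} {v : EuclideanSpace ℝ (Fin p)}
    (hv : ∀ j ∉ T, v j = 0) : ‖restrict T v‖ = ‖v‖ := by
  rw [EuclideanSpace.norm_eq, EuclideanSpace.norm_eq]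
  congr 1
  simp only [restrict]
  rw [Finset.sum_coe_sort T fun j => ‖v j‖ ^ 2]
  exact Finset.sum_subset (Finset.subset_univ T) fun j _ hj => by simp [hv j hj]

theorem restrict_sub {p : ℕ} (T : Finset (Fin p)) (u v : EuclideanSpace ℝ (Fin p)) :
    restrict T (u - v) = restrict T u - restrict T v := by
  ext j; simp [restrict]

/-! ### Regularity of the local losses with high probability. -/

namespace Model

variable {p : ℕ} {Ω : Type*} {S : Model p Ω}

/-- The local losses are smooth near `θ₀`, with second derivatives that are uniformly elliptic,
bounded and Lipschitz. -/
structure RegularAt (S : Model p Ω) (δ c C M : ℝ) (N : ℕ) (ω : Ω) : Prop where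
  contDiffAt : ∀ i, ∀ θ ∈ Metric.closedBall S.θ₀ δ,
    ContDiffAt ℝ 2 (fun θ' => S.loss θ' (S.Z N i ω)) θ
  lipschitz : ∀ k, SecondDerivLipschitz (S.localLoss N ω k) (Metric.closedBall S.θ₀ δ) M
  coercive : ∀ k v, c * ‖v‖ ^ 2 ≤ fderiv ℝ (fderiv ℝ (S.localLoss N ω k)) S.θ₀ v v
  bounded : ∀ k, ‖fderiv ℝ (fderiv ℝ (S.localLoss N ω k)) S.θ₀‖ ≤ C

theorem fderiv_localLoss_single {N : ℕ} {ω : Ω}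
    (hsm : ∀ i, ContDiffAt ℝ 2 (fun θ' => S.loss θ' (S.Z N i ω)) S.θ₀) (k : Fin (S.K N))
    (a : Fin p) : fderiv ℝ (S.localLoss N ω k) S.θ₀ (EuclideanSpace.single a 1) =
      S.localMean (fun z => pd1 (fun θ => S.loss θ z) S.θ₀ a) N ω k := by
  rw [localLoss_eq_sum, fderiv_weighted_sum fun i _ => (hsm i).differentiableAt (by simp)]
  simp [localMean, pd1, Finset.mul_sum]

theorem fderiv_globalLoss_single {N : ℕ} {ω : Ω}
    (hsm : ∀ i, ContDiffAt ℝ 2 (fun θ' => S.loss θ' (S.Z N i ω)) S.θ₀)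
    (a : Fin p) : fderiv ℝ (S.globalLoss N ω) S.θ₀ (EuclideanSpace.single a 1) =
      (N : ℝ)⁻¹ * ∑ i, pd1 (fun θ => S.loss θ (S.Z N i ω)) S.θ₀ a := by
  have h : S.globalLoss N ω = fun θ => ∑ i, (N : ℝ)⁻¹ * S.loss θ (S.Z N i ω) := by
    funext θ; simp [globalLoss, Finset.mul_sum]
  rw [h, fderiv_weighted_sum fun i _ => (hsm i).differentiableAt (by simp)]
  simp [pd1, Finset.mul_sum]

theorem norm_fderiv_localLoss_sq_le {N : ℕ} {ω : Ω}
    (hsm : ∀ i, ContDiffAt ℝ 2 (fun θ' => S.loss θ' (S.Z N i ω)) S.θ₀) (k : Fin (S.K N)) :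
    ‖fderiv ℝ (S.localLoss N ω k) S.θ₀‖ ^ 2 ≤
      p * ∑ a, S.localMean (fun z => pd1 (fun θ => S.loss θ z) S.θ₀ a) N ω k ^ 2 := by
  have h1 := norm_le_sum_single (fderiv ℝ (S.localLoss N ω k) S.θ₀)
  simp only [fderiv_localLoss_single hsm] at h1
  refine (pow_le_pow_left₀ (norm_nonneg _) h1 2).trans ?_
  refine sq_sum_le_card_mul_sum_sq.trans_eq ?_
  simp [sq_abs]

theorem secondDerivLipschitz_localLoss {N : ℕ} {ω : Ω} {s : Set (EuclideanSpace ℝ (Fin p))}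
    {Mb : Fin p → Fin p → Fin p → EuclideanSpace ℝ (Fin p) × ℝ → ℝ}
    (h : ∀ i, SecondDerivLipschitz (fun θ => S.loss θ (S.Z N i ω)) s
      (∑ a, ∑ b, ∑ l, Mb a b l (S.Z N i ω))) (k : Fin (S.K N)) :
    SecondDerivLipschitz (S.localLoss N ω k) s (∑ a, ∑ b, ∑ l, S.localMean (Mb a b l) N ω k) := by
  have h1 := SecondDerivLipschitz.weighted_sum (t := S.block N k)
    (c := fun _ => (S.size N k : ℝ)⁻¹) (fun i _ => by positivity) (fun i _ => h i)
  rw [← localLoss_eq_sum] at h1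
  refine h1.mono_const (le_of_eq ?_)
  simp only [localMean, ← Finset.mul_sum]
  congr 1
  rw [Finset.sum_comm]
  refine Finset.sum_congr rfl fun a _ => ?_
  rw [Finset.sum_comm]
  refine Finset.sum_congr rfl fun b _ => ?_
  rw [Finset.sum_comm]

/-- An entrywise error `τ` changes the form by at most `p * p * τ * ‖v‖ ^ 2`, since there are `p *
p` entries. -/
theorem coercive_of_abs_sub_info_le {N : ℕ} {ω : Ω} {c τ : ℝ} (k : Fin (S.K N))
    (hsm : ∀ i, ContDiffAt ℝ 2 (fun θ' => S.loss θ' (S.Z N i ω)) S.θ₀)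
    (hinfo : ∀ u : Fin p → ℝ, c * (u ⬝ᵥ u) ≤ u ⬝ᵥ (S.info k *ᵥ u))
    (hclose : ∀ a b, |S.localHessian N ω k S.θ₀ a b - S.info k a b| ≤ τ)
    (v : EuclideanSpace ℝ (Fin p)) :
    (c - p * p * τ) * ‖v‖ ^ 2 ≤ fderiv ℝ (fderiv ℝ (S.localLoss N ω k)) S.θ₀ v v := by
  rw [← S.dotProduct_localHessian k hsm]
  have h1 := hinfo v.ofLp
  have h2 : v.ofLp ⬝ᵥ v.ofLp = ‖v‖ ^ 2 := by
    rw [EuclideanSpace.real_norm_sq_eq]; simp [dotProduct, sq]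
  rw [h2] at h1
  have h3 : v.ofLp ⬝ᵥ (S.localHessian N ω k S.θ₀ *ᵥ v.ofLp) - v.ofLp ⬝ᵥ (S.info k *ᵥ v.ofLp) =
      ∑ a, ∑ b, v a * (S.localHessian N ω k S.θ₀ a b - S.info k a b) * v b := by
    simp only [dotProduct, Matrix.mulVec, Finset.mul_sum, ← Finset.sum_sub_distrib]
    exact Finset.sum_congr rfl fun a _ => Finset.sum_congr rfl fun b _ => by ring
  have h4 : |∑ a, ∑ b, v a * (S.localHessian N ω k S.θ₀ a b - S.info k a b) * v b| ≤
      ∑ _a : Fin p, ∑ _b : Fin p, ‖v‖ * τ * ‖v‖ := by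
    refine (Finset.abs_sum_le_sum_abs _ _).trans (Finset.sum_le_sum fun a _ => ?_)
    refine (Finset.abs_sum_le_sum_abs _ _).trans (Finset.sum_le_sum fun b _ => ?_)
    rw [abs_mul, abs_mul]
    have := (abs_nonneg _).trans (hclose a b)
    exact mul_le_mul (mul_le_mul (abs_coord_le v a) (hclose a b) (abs_nonneg _) (norm_nonneg _))
      (abs_coord_le v b) (abs_nonneg _) (by positivity)
  rw [← h3] at h4
  simp only [Finset.sum_const, Finset.card_univ, Fintype.card_fin, nsmul_eq_mul] at h4
  have h5 := (abs_le.1 h4).1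
  nlinarith

variable [MeasurableSpace Ω] {P : Measure Ω}

/-- Outside the `ρ`-ball identifiability puts the loss strictly above its value at `θ₀`, which a
minimizer cannot exceed. This is consistency without a rate, simultaneously for all workers. -/
theorem IsLocalEstimator.withHighProb_norm_sub_le
    {θhat : (N : ℕ) → Ω → Fin (S.K N) → EuclideanSpace ℝ (Fin p)}
    (h : S.IsLocalEstimator P θhat) (hspace : S.ParameterSpace) (hid : S.Identifiability P) {ρ : ℝ}
    (hρ : 0 < ρ) : WithHighProb P fun N ω => ∀ k, ‖θhat N ω k - S.θ₀‖ ≤ ρ ∧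
      IsMinOn (S.localLoss N ω k) S.Θ (θhat N ω k) := by
  obtain ⟨ε, hε, hsep⟩ := hid.1 ρ hρ
  refine (hsep.and h).mono (Eventually.of_forall fun N ω ⟨h1, h2⟩ k => ⟨?_, (h2 k).2⟩)
  by_contra hlt
  have h3 := h1 k _ (h2 k).1 (not_le.1 hlt).le
  have h4 : S.localLoss N ω k (θhat N ω k) ≤ S.localLoss N ω k S.θ₀ :=
    (h2 k).2 (interior_subset hspace.2.2)
  linarith

variable [IsProbabilityMeasure P]
  {Mb : Fin p → Fin p → Fin p → EuclideanSpace ℝ (Fin p) × ℝ → ℝ}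

theorem Sampling.exists_regularAt (hs : S.Sampling P) (hbal : S.BalancedWorkers)
    (hn : Tendsto (fun N : ℕ => S.avgSize N / Real.sqrt N) atTop atTop)
    (hspace : S.ParameterSpace) (hconv : S.LocalConvexity) (hsmooth : S.SmoothnessWith Mb)
    (hK : (∃ K₀ : ℕ, ∀ N, S.K N ≤ K₀) ∨ S.UniformMoments Mb) {c v : ℝ}
    (hmb : S.MomentBounds Mb c v) :
    ∃ δ M : ℝ, 0 < δ ∧ 0 ≤ M ∧ Metric.closedBall S.θ₀ δ ⊆ S.Θ ∧
      WithHighProb P (S.RegularAt δ (c / 2) (∑ _a : Fin p, ∑ _b : Fin p, (v + 1)) M) := by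
  obtain ⟨δ₁, hδ₁, hsm⟩ := id hsmooth
  obtain ⟨δ₂, hδ₂, hball⟩ := Metric.nhds_basis_closedBall.mem_iff.1
    (mem_interior_iff_mem_nhds.1 hspace.2.2)
  set δ := min δ₁ δ₂ with hδ
  have hδ0 : 0 < δ := lt_min hδ₁ hδ₂
  have hsub : Metric.closedBall S.θ₀ δ ⊆ S.Θ :=
    (Metric.closedBall_subset_closedBall (min_le_right _ _)).trans hball
  have hc := hmb.pos
  have hv := hmb.nonneg
  refine ⟨δ, ∑ _i : Fin p, ∑ _j : Fin p, ∑ _l : Fin p, (v + 1), hδ0, by positivity, hsub, ?_⟩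
  -- The second entry makes `p * p * τ ≤ c / 2`, preserving half of the ellipticity; the first keeps
  -- the Hessian entries below `v + 1`.
  set τ : ℝ := min 1 (c / (2 * (p * p + 1))) with hτ
  have hτ0 : 0 < τ := by positivity
  have hae : WithHighProb P fun N ω => ∀ i, ∀ θ ∈ Metric.closedBall S.θ₀ δ,
      ContDiffAt ℝ 2 (fun θ' => S.loss θ' (S.Z N i ω)) θ ∧
      DifferentiableAt ℝ (iteratedFDeriv ℝ 2 (fun θ' => S.loss θ' (S.Z N i ω))) θ ∧
      ∀ a b l, |pd3 (fun θ' => S.loss θ' (S.Z N i ω)) θ a b l| ≤ Mb a b l (S.Z N i ω) := by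
    refine withHighProb_of_eventually_ae (Eventually.of_forall fun N => ?_)
    refine (hs.ae_forall_of_ae fun k => (hsm N k).1).mono fun ω hω i θ hθ => ?_
    refine hω i θ (hsub hθ) ?_
    rw [← dist_eq_norm]
    exact (Metric.mem_closedBall.1 hθ).trans (min_le_left _ _)
  have hhess : WithHighProb P fun N ω => ∀ a b, ∀ k : Fin (S.K N),
      |S.localMean (fun z => pd2 (fun θ => S.loss θ z) S.θ₀ a b) N ω k -
        ∫ z, pd2 (fun θ => S.loss θ z) S.θ₀ a b ∂(S.law k)| ≤ τ := by
    refine withHighProb_forall fun a => withHighProb_forall fun b => ?_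
    refine hs.withHighProb_localMean hbal hn (fun N _ k => ((hconv N k).2.1 a b).1) ?_ hτ0
    exact hK.imp id fun ⟨_, _, C, _, _, h⟩ => ⟨C, fun N _ k => (h N k).2.2.1 a b⟩
  have hthird : WithHighProb P fun N ω => ∀ i j l, ∀ k : Fin (S.K N),
      |S.localMean (Mb i j l) N ω k - ∫ z, Mb i j l z ∂(S.law k)| ≤ 1 := by
    refine withHighProb_forall fun i => withHighProb_forall fun j => withHighProb_forall fun l => ?_
    refine hs.withHighProb_localMean hbal hn (fun N _ k => (hsm N k).2 i j l) ?_ one_pos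
    exact hK.imp id fun ⟨_, _, C, _, _, h⟩ => ⟨C, fun N _ k => (h N k).2.2.2 i j l⟩
  refine ((hae.and hhess).and hthird).mono ?_
  filter_upwards [eventually_gt_atTop 0] with N hN ω ⟨⟨hreg, hH⟩, hT⟩
  have h0 : S.θ₀ ∈ Metric.closedBall S.θ₀ δ := Metric.mem_closedBall_self hδ0.le
  have hreg₀ (i) := (hreg i _ h0).1
  refine ⟨fun i θ hθ => (hreg i θ hθ).1, fun k => ?_, fun k u => ?_, fun k => ?_⟩
  · refine (secondDerivLipschitz_localLoss (fun i => secondDerivLipschitz_of_pd3_le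
      (convex_closedBall _ _) ⟨_, h0⟩ (hreg i)) k).mono_const ?_
    gcongr with i _ j _ l _
    linarith [(abs_le.1 (hT i j l k)).2, hmb.third_le N hN k i j l]
  · have hclose (a b) : |S.localHessian N ω k S.θ₀ a b - S.info k a b| ≤ τ := by
      -- The information matrix is defined through gradients; local convexity identifies it with the
      -- mean Hessian, to which the law of large numbers applies.
      rw [← ((hconv N k).2.1 a b).2]
      exact hH a b k
    refine le_trans ?_ (coercive_of_abs_sub_info_le k hreg₀ (hmb.info_ge N hN k) hclose u)
    refine mul_le_mul_of_nonneg_right ?_ (sq_nonneg _)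
    have h1 : p * p * τ ≤ p * p * (c / (2 * (p * p + 1))) := by gcongr; exact min_le_right _ _
    have h2 : (p : ℝ) * p * (c / (2 * (p * p + 1))) ≤ c / 2 := by
      rw [mul_div_assoc', div_le_div_iff₀ (by positivity) (by positivity)]
      nlinarith
    linarith
  · refine (norm_le_sum_single₂ _).trans ?_
    gcongr with a _ b _
    rw [← S.localHessian_apply k hreg₀]
    have h1 := hH a b k
    have h2 : τ ≤ 1 := min_le_left _ _
    have h3 := hmb.hess_le N hN k a b
    change |S.localMean (fun z => pd2 (fun θ => S.loss θ z) S.θ₀ a b) N ω k| ≤ v + 1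
    rw [abs_le] at *
    constructor <;> linarith [h1.1, h1.2, h3.1, h3.2]

end Model

/-- Arithmetic with `s = √N`: `hX` bounds `s * X`, so `hb` verifies the sparsity threshold and
unlocks `hD`. After scaling, the term quadratic in `Y` gains a factor `s⁻¹`, and the term `M * ρ *
Y` is small only through `ρ`. -/
theorem scaled_dist_le {c C M ρ R τ ε a b g q X Y D s d : ℝ} (hc : 0 < c) (hC : 0 ≤ C)
    (hM : 0 ≤ M) (hρ : 0 ≤ ρ) (hs : 0 < s) (hd : 0 ≤ d) (hY : 0 ≤ Y)
    (hX : c / 2 * X ≤ 2 * (g + q) + d * a)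
    (hD : 2 * (C + c / 2) * X + 2 * (g + q) < b →
      c / 2 * D ≤ M * ρ * Y + M * Y ^ 2 + q + d * a)
    (hg : s * g ≤ R) (hsY : s * Y ≤ R) (hq : s * q ≤ τ) (ha : s * a ≤ τ)
    (hb : 2 * (C + c / 2) * (2 / c * (2 * (R + τ) + d * τ)) + 2 * (R + τ) + 1 ≤ s * b)
    (hsmall : M * ρ * R + M * R ^ 2 * s⁻¹ + τ + d * τ ≤ c / 2 * ε) : s * D ≤ ε := by
  have hda : d * (s * a) ≤ d * τ := by gcongr
  have h1 : s * X ≤ 2 / c * (2 * (R + τ) + d * τ) := by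
    have : c / 2 * (s * X) ≤ 2 * (R + τ) + d * τ := by
      have := mul_le_mul_of_nonneg_left hX hs.le
      nlinarith
    calc s * X = 2 / c * (c / 2 * (s * X)) := by field_simp
      _ ≤ _ := by gcongr
  have h2 : 2 * (C + c / 2) * X + 2 * (g + q) < b := by
    refine lt_of_mul_lt_mul_left ?_ hs.le
    have h3 : 2 * (C + c / 2) * (s * X) ≤
        2 * (C + c / 2) * (2 / c * (2 * (R + τ) + d * τ)) := by gcongr
    nlinarith
  have h3 := mul_le_mul_of_nonneg_left (hD h2) hs.le
  have h4 : s * Y ^ 2 ≤ R ^ 2 * s⁻¹ := by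
    rw [← div_eq_mul_inv, le_div_iff₀ hs]
    have : 0 ≤ s * Y := by positivity
    nlinarith
  have h5 : M * (s * Y ^ 2) ≤ M * (R ^ 2 * s⁻¹) := by gcongr
  have h6 : M * ρ * (s * Y) ≤ M * ρ * R := by gcongr
  refine le_of_mul_le_mul_left ?_ (half_pos hc)
  nlinarith

/-! ### Stochastic comparison of the shrinkage and oracle estimators. -/

namespace Model

variable {p d₀ : ℕ} {Ω : Type*} {S : Model p Ω} [MeasurableSpace Ω] {P : Measure Ω}
  {Mb : Fin p → Fin p → Fin p → EuclideanSpace ℝ (Fin p) × ℝ → ℝ}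

theorem MomentBounds.centred {c v : ℝ} (hmb : S.MomentBounds Mb c v) (hid : S.Identifiability P)
    (hconv : S.LocalConvexity) (a : Fin p) (N : ℕ) (hN : 0 < N) (k : Fin (S.K N)) :
    MemLp (fun z => pd1 (fun θ => S.loss θ z) S.θ₀ a) 2 (S.law k) ∧
      ∫ z, pd1 (fun θ => S.loss θ z) S.θ₀ a ∂(S.law k) = 0 ∧
      ∫ z, pd1 (fun θ => S.loss θ z) S.θ₀ a ^ 2 ∂(S.law k) ≤ v :=
  ⟨(hconv N k).1 a, (hid.2 N k a).2, hmb.grad_le N hN k a⟩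

variable [IsProbabilityMeasure P]

/-- The rescaled score at `θ₀` is bounded in probability. -/
theorem Sampling.boundedInProb_score (hs : S.Sampling P) (hid : S.Identifiability P)
    (hconv : S.LocalConvexity) {c v δ c' C M : ℝ} (hmb : S.MomentBounds Mb c v) (hδ : 0 ≤ δ)
    (hreg : WithHighProb P (S.RegularAt δ c' C M)) :
    BoundedInProb P fun N ω => Real.sqrt N * ‖fderiv ℝ (S.globalLoss N ω) S.θ₀‖ := by
  refine (boundedInProb_sum fun a : Fin p =>
    hs.boundedInProb_globalMean (hmb.centred hid hconv a)).mono ?_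
  refine hreg.mono (Eventually.of_forall fun N ω h => ?_)
  rw [← Finset.mul_sum]
  gcongr
  refine (norm_le_sum_single _).trans_eq (Finset.sum_congr rfl fun a _ => ?_)
  rw [fderiv_globalLoss_single fun i => h.contDiffAt i _ (Metric.mem_closedBall_self hδ)]

/-- The weighted squared norms of the local scores at `θ₀` are `o_p(N^{-1/2})`. -/
theorem Sampling.withHighProb_weighted_score_le (hs : S.Sampling P) (hbal : S.BalancedWorkers)
    (hn : Tendsto (fun N : ℕ => S.avgSize N / Real.sqrt N) atTop atTop)
    (hid : S.Identifiability P) (hconv : S.LocalConvexity) {c v δ c' C M : ℝ}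
    (hmb : S.MomentBounds Mb c v) (hδ : 0 ≤ δ) (hreg : WithHighProb P (S.RegularAt δ c' C M))
    {ε : ℝ} (hε : 0 < ε) :
    WithHighProb P fun N ω => Real.sqrt N *
      ∑ k, S.weight N k * ‖fderiv ℝ (S.localLoss N ω k) S.θ₀‖ ^ 2 ≤ ε := by
  -- One factor `p` comes from squaring a sum of `p` partial derivatives, the other from summing
  -- over the coordinates.
  have hε' : 0 < ε / (p * p + 1) := by positivity
  have h1 := withHighProb_forall fun a : Fin p =>
    hs.withHighProb_weighted_sq_localMean_le hbal hn (hmb.centred hid hconv a) hε'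
  refine (h1.and hreg).mono (Eventually.of_forall fun N ω ⟨hsmall, h⟩ => ?_)
  calc _ ≤ Real.sqrt N * ∑ k, S.weight N k * (p * ∑ a,
        S.localMean (fun z => pd1 (fun θ => S.loss θ z) S.θ₀ a) N ω k ^ 2) := by
        refine mul_le_mul_of_nonneg_left (Finset.sum_le_sum fun k _ =>
          mul_le_mul_of_nonneg_left ?_ (S.weight_nonneg k)) (Real.sqrt_nonneg _)
        exact norm_fderiv_localLoss_sq_le
          (fun i => h.contDiffAt i _ (Metric.mem_closedBall_self hδ)) k
    _ = p * ∑ a, Real.sqrt N * ∑ k, S.weight N k *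
        S.localMean (fun z => pd1 (fun θ => S.loss θ z) S.θ₀ a) N ω k ^ 2 := by
        simp only [Finset.mul_sum]
        rw [Finset.sum_comm]
        refine Finset.sum_congr rfl fun a _ => Finset.sum_congr rfl fun k _ => by ring
    _ ≤ p * ∑ _a : Fin p, ε / (p * p + 1) := by
        gcongr with a _; exact hsmall a
    _ ≤ ε := by
        rw [Finset.sum_const, Finset.card_univ, Fintype.card_fin, nsmul_eq_mul, mul_div_assoc',
          mul_div_assoc', div_le_iff₀ (by positivity)]
        nlinarith

/-- The rescaled oracle estimator is bounded in probability. -/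
theorem AsymptoticallyNormal.boundedInProb {T : Finset (Fin p)}
    {θor : ℕ → Ω → EuclideanSpace ℝ (Fin p)} {V : Matrix T T ℝ}
    (h : S.AsymptoticallyNormal P T θor V) (hθ₀ : ∀ j ∉ T, S.θ₀ j = 0)
    (hor : S.IsGlobalEstimator P T θor) :
    BoundedInProb P fun N ω => Real.sqrt N * ‖θor N ω - S.θ₀‖ := by
  refine (boundedInProb_norm_of_tendstoInDistribution h).mono ?_
  refine hor.mono (Eventually.of_forall fun N ω hω => ?_)
  rw [norm_smul, Real.norm_of_nonneg (Real.sqrt_nonneg _), ← restrict_sub,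
    norm_restrict_eq fun j hj => by simp [hω.1.2 j hj, hθ₀ j hj]]

/-- The shrinkage estimator and the oracle estimator differ by `o_p(N^{-1/2})`. -/
theorem withHighProb_sqrt_mul_norm_sub_le (hsupp : ∀ j : Fin p, S.θ₀ j ≠ 0 ↔ (j : ℕ) < d₀)
    (hbal : S.BalancedWorkers)
    (hn : Tendsto (fun N : ℕ => S.avgSize N / Real.sqrt N) atTop atTop)
    (hspace : S.ParameterSpace) (hs : S.Sampling P) (hid : S.Identifiability P)
    (hconv : S.LocalConvexity) (hsmooth : S.SmoothnessWith Mb)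
    (hK : (∃ K₀ : ℕ, ∀ N, S.K N ≤ K₀) ∨ S.UniformMoments Mb)
    {θor : ℕ → Ω → EuclideanSpace ℝ (Fin p)}
    (hor : S.IsGlobalEstimator P (trueModel p d₀) θor)
    (hor_bdd : BoundedInProb P fun N ω => Real.sqrt N * ‖θor N ω - S.θ₀‖)
    {θhat : (N : ℕ) → Ω → Fin (S.K N) → EuclideanSpace ℝ (Fin p)}
    (hθhat : S.IsLocalEstimator P θhat)
    {lam : ℕ → Ω → Fin p → ℝ} (hlam : ∀ N ω j, 0 ≤ lam N ω j)
    (ha : TendstoInMeasure P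
      (fun (N : ℕ) ω => Real.sqrt N * aLam d₀ (lam N ω)) atTop (fun _ => 0))
    (hb : TendstoInProbAtTop P (fun (N : ℕ) ω => Real.sqrt N * bLam d₀ (lam N ω)))
    {θlam : ℕ → Ω → EuclideanSpace ℝ (Fin p)} (hθlam : S.IsShrinkageEstimator P θhat lam θlam)
    {ε : ℝ} (hε : 0 < ε) :
    WithHighProb P fun N ω => Real.sqrt N * ‖θor N ω - θlam N ω‖ ≤ ε := by
  obtain ⟨c₀, v, hmb⟩ := hs.exists_momentBounds hbal hconv hsmooth hK
  obtain ⟨δ, M, hδ, hM, hball, hreg⟩ := hs.exists_regularAt hbal hn hspace hconv hsmooth hK hmb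
  have hv := hmb.nonneg
  set c := c₀ / 2 with hc_def
  set C : ℝ := ∑ _a : Fin p, ∑ _b : Fin p, (v + 1) with hC_def
  have hc : 0 < c := half_pos hmb.pos
  have hC : 0 ≤ C := by positivity
  have hT (j : Fin p) : j ∈ trueModel p d₀ ↔ (j : ℕ) < d₀ := by simp [trueModel]
  have hθ₀ : ∀ j ∉ trueModel p d₀, S.θ₀ j = 0 := fun j hj => by
    by_contra hne
    exact hj ((hT j).2 ((hsupp j).1 hne))
  -- The rescaled score and oracle error are fixed below `R₁` and `R₂` first, so that the radius `ρ`
  -- may depend on these bounds.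
  refine (hs.boundedInProb_score hid hconv hmb hδ.le hreg).withHighProb fun R₁ => ?_
  refine hor_bdd.withHighProb fun R₂ => ?_
  set R : ℝ := max 0 (max R₁ R₂) with hR
  have hR0 : 0 ≤ R := le_max_left _ _
  -- The three entries keep the local estimators in the smooth ball, preserve ellipticity, and make
  -- `M * ρ * R` at most `c * ε / 8`. The shifts by `1` exclude division by zero.
  set ρ : ℝ := min (δ / 2) (min (c / (2 * (M + 1))) (c * ε / (8 * ((M + 1) * (R + 1))))) with hρ_def
  have hρ : 0 < ρ := by positivity
  have hρδ : ρ < δ := (min_le_left _ _).trans_lt (half_lt_self hδ)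
  have hMρ : M * ρ ≤ c / 2 := by
    calc M * ρ ≤ (M + 1) * (c / (2 * (M + 1))) := by
          gcongr
          · linarith
          · exact (min_le_right _ _).trans (min_le_left _ _)
      _ = c / 2 := by field_simp
  have hMρR : M * ρ * R ≤ c * ε / 8 := by
    calc M * ρ * R ≤ (M + 1) * (c * ε / (8 * ((M + 1) * (R + 1)))) * (R + 1) := by
          gcongr
          · linarith
          · exact (min_le_right _ _).trans (min_le_right _ _)
          · linarith
      _ = c * ε / 8 := by field_simp
  -- With this choice `τ + p * τ = c * ε / 8`. The error budget is three such eighths, within the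
  -- allowed `c / 2 * ε`.
  set τ : ℝ := c * ε / (8 * (p + 1)) with hτ_def
  have hτ : 0 < τ := by positivity
  have hpτ : τ + p * τ = c * ε / 8 := by rw [hτ_def]; field_simp; ring
  set κ : ℝ := M * (4 / c ^ 2) with hκ
  have hκ0 : 0 ≤ κ := by positivity
  have hscore := hs.withHighProb_weighted_score_le hbal hn hid hconv hmb hδ.le hreg
    (ε := τ / (κ + 1)) (by positivity)
  have hpen : WithHighProb P fun N ω => Real.sqrt N * aLam d₀ (lam N ω) ≤ τ := by
    have h1 := (tendstoInMeasure_iff_norm.1 ha) τ hτ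
    refine tendsto_of_tendsto_of_tendsto_of_le_of_le tendsto_const_nhds h1
      (fun _ => zero_le) fun N => measure_mono fun ω hω => ?_
    have h2 : τ < Real.sqrt N * aLam d₀ (lam N ω) := not_le.1 hω
    change τ ≤ ‖Real.sqrt N * aLam d₀ (lam N ω) - 0‖
    rw [sub_zero]
    exact h2.le.trans (le_abs_self _)
  -- The divergence of `√N b_λ` is used at one fixed level: the sparsity threshold plus `1` for
  -- strictness.
  have hbig := hb (2 * (C + c / 2) * (2 / c * (2 * (R + τ) + p * τ)) + 2 * (R + τ) + 1)
  have hloc := hθhat.withHighProb_norm_sub_le hspace hid hρ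
  have hsqrt : Tendsto (fun N : ℕ => Real.sqrt N) atTop atTop :=
    Real.tendsto_sqrt_atTop.comp tendsto_natCast_atTop_atTop
  have hinv : Tendsto (fun N : ℕ => M * R ^ 2 * (Real.sqrt N)⁻¹) atTop (𝓝 0) := by
    simpa using (tendsto_inv_atTop_zero.comp hsqrt).const_mul (M * R ^ 2)
  refine (((((hreg.and hscore).and hpen).and hbig).and hloc).and (hor.and hθlam)).mono ?_
  filter_upwards [eventually_gt_atTop 0, hsqrt.eventually_gt_atTop (R / δ),
    hinv.eventually_le_const (by positivity : (0 : ℝ) < c * ε / 8)] with N hN hNδ hNsmall ω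
    ⟨⟨⟨⟨⟨hω, hω_score⟩, hω_a⟩, hω_b⟩, hω_loc⟩, hω_or, hω_lam⟩ hR₂ hR₁
  have hsN : 0 < Real.sqrt N := Real.sqrt_pos.2 (by exact_mod_cast hN)
  have hcε : 0 < c * ε := by positivity
  have hR₁' : _ ≤ R := hR₁.trans ((le_max_left R₁ R₂).trans (le_max_right 0 _))
  have hR₂' : _ ≤ R := hR₂.trans ((le_max_right R₁ R₂).trans (le_max_right 0 _))
  -- The oracle enters the smooth ball once `√N > R / δ`.
  have hnear : ‖θor N ω - S.θ₀‖ < δ := by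
    rw [div_lt_iff₀ hδ] at hNδ
    exact lt_of_mul_lt_mul_left (hR₂'.trans_lt hNδ) hsN.le
  have ha0 : 0 ≤ aLam d₀ (lam N ω) := Real.iSup_nonneg fun j => hlam N ω j
  obtain ⟨hX, hD⟩ := S.shrinkage_oracle_bounds hN (hbal.size_pos hN) hθ₀ hball hρ.le hρδ hc hMρ
    hω.contDiffAt hω.lipschitz hω.coercive hω.bounded (fun k => (hω_loc k).1)
    (fun k => (hω_loc k).2) (hlam N ω) ha0
    (fun j hj => lam_le_aLam _ ((hT j).1 hj)) (fun j hj => bLam_le_lam _ (mt (hT j).2 hj)) hω_lam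
    hω_or.1.2 hnear hω_or.2 le_rfl le_rfl
  refine scaled_dist_le hc hC hM hρ.le hsN p.cast_nonneg (norm_nonneg _) hX hD hR₁' hR₂' ?_ hω_a
    hω_b (by linarith)
  calc _ = κ * (Real.sqrt N * ∑ k, S.weight N k * ‖fderiv ℝ (S.localLoss N ω k) S.θ₀‖ ^ 2) := by
        ring
    _ ≤ κ * (τ / (κ + 1)) := by gcongr
    _ ≤ τ := by
        rw [mul_div_assoc', div_le_iff₀ (by positivity)]
        nlinarith

end Model

/-! ### Transfer of the limit law. -/

theorem measurable_restrict {p : ℕ} (M : Finset (Fin p)) : Measurable (restrict (p := p) M) := by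
  have : Continuous (restrict (p := p) M) := by
    unfold restrict
    fun_prop
  exact this.measurable

end DLSA

theorem theorem3 {p d₀ : ℕ} (hd₀ : 0 < d₀) (hd₀p : d₀ < p)
    {Ω : Type*} [MeasurableSpace Ω] (P : Measure Ω) [IsProbabilityMeasure P]
    (S : DLSA.Model p Ω)
    (hsupp : ∀ j : Fin p, S.θ₀ j ≠ 0 ↔ (j : ℕ) < d₀)
    (hbal : S.BalancedWorkers)
    (hn : Tendsto (fun N : ℕ => S.avgSize N / Real.sqrt N) atTop atTop)
    (hspace : S.ParameterSpace)
    (hsamp : S.Sampling P)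
    (hid : S.Identifiability P)
    (hconv : S.LocalConvexity)
    (Mb : Fin p → Fin p → Fin p → EuclideanSpace ℝ (Fin p) × ℝ → ℝ)
    (hsmooth : S.SmoothnessWith Mb)
    (hK : (∃ K₀ : ℕ, ∀ N, S.K N ≤ K₀) ∨ S.UniformMoments Mb)
    (θM : Finset (Fin p) → ℕ → Ω → EuclideanSpace ℝ (Fin p))
    (SigmaM : (M : Finset (Fin p)) → Matrix M M ℝ)
    (hcov : S.CovarianceAssumption P (DLSA.trueModel p d₀) θM SigmaM)
    (θhat : (N : ℕ) → Ω → Fin (S.K N) → EuclideanSpace ℝ (Fin p))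
    (hθhat : S.IsLocalEstimator P θhat)
    (lam : ℕ → Ω → Fin p → ℝ) (hlam : ∀ N ω j, 0 ≤ lam N ω j)
    (ha : TendstoInMeasure P
      (fun (N : ℕ) ω => Real.sqrt N * DLSA.aLam d₀ (lam N ω)) atTop (fun _ => 0))
    (hb : DLSA.TendstoInProbAtTop P
      (fun (N : ℕ) ω => Real.sqrt N * DLSA.bLam d₀ (lam N ω)))
    (θlam : ℕ → Ω → EuclideanSpace ℝ (Fin p))
    (hθlam_meas : ∀ N, AEMeasurable (θlam N) P)
    (hθlam : S.IsShrinkageEstimator P θhat lam θlam) :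
    S.AsymptoticallyNormal P (DLSA.trueModel p d₀) θlam (SigmaM (DLSA.trueModel p d₀)) := by
  obtain ⟨hor, -, hnormal, -⟩ := hcov (DLSA.trueModel p d₀) (Finset.Subset.refl _)
  have hθ₀ : ∀ j ∉ DLSA.trueModel p d₀, S.θ₀ j = 0 := fun j hj => by
    by_contra hne
    exact hj (by simpa [DLSA.trueModel] using (hsupp j).1 hne)
  -- Slutsky's theorem: the limit law of the oracle passes to any sequence at vanishing distance in
  -- probability. Measurability of the shrinkage estimator enters here.
  refine tendstoInDistribution_of_tendstoInMeasure_sub _ _ hnormal ?_ fun N => by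
    have hmeas := (DLSA.measurable_restrict (DLSA.trueModel p d₀)).comp_aemeasurable (hθlam_meas N)
    exact (hmeas.sub_const (DLSA.restrict _ S.θ₀)).const_smul (Real.sqrt N)
  refine tendstoInMeasure_iff_norm.2 fun ε hε => ?_
  have h := DLSA.Model.withHighProb_sqrt_mul_norm_sub_le hsupp hbal hn hspace hsamp hid hconv
    hsmooth hK hor (hnormal.boundedInProb hθ₀ hor) hθhat hlam ha hb hθlam (half_pos hε)
  refine tendsto_of_tendsto_of_tendsto_of_le_of_le tendsto_const_nhds h
    (fun _ => zero_le) fun N => measure_mono fun ω hω => ?_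
  -- Convergence in measure concerns deviations of at least `ε`, so the bound at `ε / 2` supplies
  -- the strict inequality.
  refine not_le.2 (lt_of_lt_of_le (half_lt_self hε) (le_trans hω ?_))
  simp only [Pi.sub_apply, Pi.zero_apply, sub_zero]
  rw [← smul_sub, sub_sub_sub_cancel_right, ← DLSA.restrict_sub, norm_smul,
    Real.norm_of_nonneg (Real.sqrt_nonneg _), norm_sub_rev (θM _ N ω)]
  gcongr
  exact DLSA.norm_restrict_le _ _
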